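/- Let $\log$ denote the logarithm to base $2$, and for $x\in\mathbb{R}$ let $\|x\|$ denote the distance from $x$ to the nearest integer. For a function $\psi:\mathbb{N}\to[0,\infty)$ (with $\mathbb{N}=\{1,2,3,\dots\}$) and real numbers $\beta,\gamma,\gamma'$, put $$W(\psi,\beta,\gamma,\gamma')=\{x\in[0,1]:\ \|qx-\gamma\|\,\|q\beta-\gamma'\|<\psi(q)\text{ for infinitely many }q\in\mathbb{N}\}.$$ For real numbers $\gamma,\beta$ and an integer $N\ge 1$, let $\sigma_{(\gamma,\beta)}(N)\in[0,\infty]$ be the infimum (equal to $\infty$ if there is no such number) of all $\sigma>0$ such that $$\|k_1\gamma+k_2\beta\|\ge \max\{|k_1|,|k_2|\}^{-\sigma}$$ for all integers $k_1,k_2$ with $2\le\max\{|k_1|,|k_2|\}\le N$. Theorem. Let $\psi:\mathbb{N}\to[0,\infty)$ be monotonic (non-increasing or non-decreasing) with $$\sum_{q=3}^{\infty}\psi(q)\frac{\log q}{(\log\log q)^{1/2}}=\infty .$$ Let $\gamma,\beta$ be irrational numbers for which there is a constant $C$ such that $\sigma_{(\gamma,\beta)}(q)\le C(\log\log q)^{1/2}$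 for all integers $q\ge 3$. Let $\gamma'$ be any real number. Then $W(\psi,\beta,\gamma,\gamma')$ has Lebesgue measure $1$. -/

import Mathlib

open scoped ENNReal

/-- The distance `‖x‖` of a real number `x` to the nearest integer. -/
noncomputable def distInt (x : ℝ) : ℝ := |x - round x|

/-- `W(ψ, β, γ, γ')`: the set of `x ∈ [0,1]` such that `‖q x - γ‖ ‖q β - γ'‖ < ψ q` for infinitely
many integers `q ≥ 1`. -/
def W (ψ : ℕ → ℝ) (β γ γ' : ℝ) : Set ℝ :=
  {x | x ∈ Set.Icc (0 : ℝ) 1 ∧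
    {q : ℕ | 1 ≤ q ∧ distInt (q * x - γ) * distInt (q * β - γ') < ψ q}.Infinite}

/-- The admissible Diophantine exponents of the pair `(γ, β)` up to height `N`.
Vectors of height `max |k₁| |k₂| = 1` are left out: for them the right hand side would be `1`
for every `s`, whereas `distInt` never exceeds `1 / 2`. -/
def diophExponents (γ β : ℝ) (N : ℕ) : Set ℝ :=
  {s | 0 < s ∧ ∀ k₁ k₂ : ℤ, 2 ≤ max |k₁| |k₂| → max |k₁| |k₂| ≤ N →
    ((max |k₁| |k₂| : ℤ) : ℝ) ^ (-s) ≤ distInt (k₁ * γ + k₂ * β)}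

/-- `σ_(γ, β)(N)`: the infimum of the admissible exponents up to height `N`, with value `∞` when
there are none (which happens when `k₁ γ + k₂ β` is an integer for one of these `k₁, k₂`). -/
noncomputable def sigmaPair (γ β : ℝ) (N : ℕ) : ℝ≥0∞ :=
  sInf (ENNReal.ofReal '' diophExponents γ β N)

/-! Let `E_q` be the set of `x` on the circle with `‖qx - γ‖ < r(q)`, where `r(q) = φ(q) / ‖qβ -
γ'‖`, `φ(q) = min(ψ(q), 1/q)`, and `r(q) = 0` unless `q` is a good index. A point in infinitely many
`E_q` lies in `W`, so for non-increasing `ψ` it suffices to show that almost every `x` does. This is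
a second moment argument, and it needs two things: `∑ r(q) = ∞`, and overlaps that exceed
independence by little.

Overlaps: averaging over rotations gives `|E_q ∩ E_q'| ≤ 2r(q')(2r(q) + gcd(q,q')/q')`. If, for each
`q'`, the sum of `gcd(q,q')/q'` over `q ≤ q'` with `E_q` meeting `E_q'` is bounded, then the
counting function has variance linear in its mean. Chebyshev's inequality then gives full measure
directly, with no zero-one law (`ae_infinite_mem_nearSet`).

The gcd sum (`sum_gcd_div_le_of_goodIndex`): for `2^k ≤ q' < 2^(k+1)`, a good `q'` has at most `2^t`
divisors, so each class `q = da`, `q' = db` with `gcd(q,q') = d` should have only `O(b/2^t)`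
members. For small `d` this holds because `‖a(dβ) - γ'‖` is small and multiples of `β` are well
distributed. For large `d`, a common point of `E_q` and `E_q'` forces `‖(b-a)γ‖` to be tiny, which
is rare since `γ` is not well approximable.

Divergence (`le_sum_block_of_goodIndex`): the Diophantine exponent up to height about `2^k` is at
most `w ≍ √(log k)`, so the shells `‖qβ - γ'‖ ≍ 2^(-j)` with `h ≤ j < 2h`, `h ≍ k/w`, carry their
expected share of each dyadic block, even after integers with many divisors are discarded. Each
shell adds `≍ 2^k φ(2^(k+1))` to `∑ r`, hence the block adds `h` times that. As `h ≍ log q / √(log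
log q)`, this is the weight of the hypothesis, by Cauchy condensation.

If `ψ` is non-decreasing it is eventually bounded below by a positive constant, and it is enough
that `‖qβ - γ'‖` is small infinitely often. -/

open MeasureTheory

/-! ### Counting along multiples of a point of the circle -/

/-- Every point of the circle has a real lift of the same absolute value. -/
theorem exists_lift_abs_eq_norm (y : UnitAddCircle) :
    ∃ u : ℝ, (u : UnitAddCircle) = y ∧ |u| = ‖y‖ := by
  induction y using QuotientAddGroup.induction_on with
  | H x =>
    refine ⟨x - round x, ?_, ?_⟩
    · rw [AddCircle.coe_sub, sub_eq_self]
      exact (AddCircle.coe_eq_zero_iff (1 : ℝ)).2 ⟨round x, by simp⟩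
    · exact (UnitAddCircle.norm_eq (x := x)).symm

theorem norm_coe_eq_abs {x : ℝ} (hx : |x| ≤ 1 / 2) : ‖(x : UnitAddCircle)‖ = |x| :=
  (AddCircle.norm_coe_eq_abs_iff (1 : ℝ) one_ne_zero).2 (by simpa using hx)

theorem coe_nat_mul (n : ℕ) (x : ℝ) :
    (((n : ℝ) * x : ℝ) : UnitAddCircle) = n • (x : UnitAddCircle) := by
  rw [← nsmul_eq_mul]; rfl

/-- A multiple of `θ` of prescribed order of magnitude, from Dirichlet's theorem. -/
theorem exists_nsmul_norm_mem_Ioc (θ : UnitAddCircle) {n : ℕ} {δ η : ℝ} (hn : 0 < n)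
    (hnδ : 1 ≤ δ * (n + 1)) (hη : 0 < η)
    (H : ∀ i : ℕ, 1 ≤ i → i ≤ n → η ≤ ‖i • θ‖) :
    ∃ (κ : ℕ) (s : ℝ), 0 < κ ∧ (κ : ℝ) ≤ n * (2 * δ / η) ∧ (s : UnitAddCircle) = κ • θ ∧
      δ < |s| ∧ |s| ≤ 2 * δ := by
  obtain ⟨k, hk, hkn⟩ := AddCircle.exists_norm_nsmul_le (T := 1) θ hn
  rw [Set.mem_Icc] at hk
  obtain ⟨u, hu, hua⟩ := exists_lift_abs_eq_norm (k • θ)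
  have h1 : |u| ≤ δ := by
    rw [hua]
    refine hkn.trans ?_
    rw [div_le_iff₀ (by positivity)]
    push_cast; exact hnδ
  have h2 : η ≤ |u| := hua ▸ H k hk.1 hk.2
  have hu0 : 0 < |u| := hη.trans_le h2
  have hδ0 : 0 < δ := hu0.trans_le h1
  have h3 : δ < (⌊δ / |u|⌋₊ + 1 : ℕ) * |u| := by
    rw [← div_lt_iff₀ hu0]; exact_mod_cast Nat.lt_floor_add_one _
  have h4 : (⌊δ / |u|⌋₊ : ℝ) * |u| ≤ δ := by
    rw [← le_div_iff₀ hu0]; exact Nat.floor_le (by positivity)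
  -- The least multiple of `u` exceeding `δ` in size; since `|u| ≤ δ` it does not overshoot `2δ`.
  refine ⟨(⌊δ / |u|⌋₊ + 1) * k, (⌊δ / |u|⌋₊ + 1 : ℕ) * u, Nat.mul_pos (Nat.succ_pos _) hk.1, ?_, ?_, ?_, ?_⟩
  · push_cast
    have h5 : (⌊δ / |u|⌋₊ : ℝ) + 1 ≤ 2 * δ / η := by
      rw [le_div_iff₀ hη]
      calc ((⌊δ / |u|⌋₊ : ℝ) + 1) * η ≤ ((⌊δ / |u|⌋₊ : ℝ) + 1) * |u| := by gcongr
        _ ≤ 2 * δ := by linarith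
    have h6 : (k : ℝ) ≤ n := by exact_mod_cast hk.2
    calc ((⌊δ / |u|⌋₊ : ℝ) + 1) * k ≤ (2 * δ / η) * n := by gcongr
      _ = _ := by ring
  · rw [coe_nat_mul, hu, mul_smul]
  · rw [abs_mul, Nat.abs_cast]; exact h3
  · rw [abs_mul, Nat.abs_cast]; push_cast; linarith

/-- The translates of the counted set by `iκ`, `i < T`, are disjoint in `[0, b + Tκ)`: a coincidence
would put a nonzero multiple of `s`, of size between `|s| > 2ρ` and `1/2`, within `2ρ` of zero. -/
theorem card_norm_sub_le (θ g : UnitAddCircle) {κ T : ℕ} (b : ℕ) {s ρ : ℝ}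
    (hs : (s : UnitAddCircle) = κ • θ) (h1 : 2 * ρ < |s|) (h2 : T * |s| ≤ 1 / 2) :
    T * ((Finset.range b).filter fun a : ℕ => ‖a • θ - g‖ ≤ ρ).card ≤ b + T * κ := by
  set A := (Finset.range b).filter fun a : ℕ => ‖a • θ - g‖ ≤ ρ with hA
  have key : ∀ i j : ℕ, ∀ a ∈ A, ∀ a' ∈ A, i < j → j < T → i * κ + a ≠ j * κ + a' := by
    intro i j a ha a' ha' hij hjT heq
    obtain ⟨e, rfl⟩ := Nat.exists_eq_add_of_lt hij
    have haa : a = (e + 1) * κ + a' := by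
      have : i * κ + a = i * κ + ((e + 1) * κ + a') := by rw [heq]; ring
      exact Nat.add_left_cancel this
    have h3 : ‖(e + 1) • (κ • θ)‖ ≤ 2 * ρ := by
      have : (e + 1) • (κ • θ) = (a • θ - g) - (a' • θ - g) := by
        rw [haa, add_smul ((e + 1) * κ), mul_smul]; abel
      rw [this]
      have e1 := (Finset.mem_filter.1 ha).2
      have e2 := (Finset.mem_filter.1 ha').2
      linarith [norm_sub_le (a • θ - g) (a' • θ - g)]
    have h5 : |((e + 1 : ℕ) : ℝ) * s| = ((e + 1 : ℕ) : ℝ) * |s| := by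
      rw [abs_mul, Nat.abs_cast]
    have h6 : ((e + 1 : ℕ) : ℝ) * |s| ≤ T * |s| := by
      gcongr; omega
    rw [← hs, ← coe_nat_mul, norm_coe_eq_abs (by rw [h5]; exact h6.trans h2), h5] at h3
    have h7 : |s| ≤ ((e + 1 : ℕ) : ℝ) * |s| := by
      refine le_mul_of_one_le_left (abs_nonneg s) ?_
      push_cast; linarith [(Nat.cast_nonneg e : (0 : ℝ) ≤ e)]
    linarith
  calc T * A.card = (Finset.range T ×ˢ A).card := by simp
    _ ≤ (Finset.range (b + T * κ)).card := by
        refine Finset.card_le_card_of_injOn (fun x => x.1 * κ + x.2) ?_ ?_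
        · rintro ⟨i, a⟩ h
          simp only [Finset.coe_product, Set.mem_prod, Finset.mem_coe, Finset.mem_range] at h
          have h3 : a < b := Finset.mem_range.1 (Finset.mem_filter.1 h.2).1
          have h4 : i * κ ≤ T * κ := Nat.mul_le_mul_right _ h.1.le
          simp only [Finset.coe_range, Set.mem_Iio]
          omega
        · rintro ⟨i, a⟩ h ⟨j, a'⟩ h' heq
          simp only [Finset.coe_product, Set.mem_prod, Finset.mem_coe, Finset.mem_range] at h h'
          simp only at heq
          rcases lt_trichotomy i j with hij | hij | hij
          · exact absurd heq (key i j a h.2 a' h'.2 hij h'.1)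
          · subst hij
            simpa using heq
          · exact absurd heq.symm (key j i a' h'.2 a h.2 hij h.1)
    _ = _ := by simp

/-- Steps of length `s` cannot jump over an arc of length `s`, and `P` of them go once round the
circle. -/
theorem exists_step_norm_mem_Ioc_of_pos (θ y : UnitAddCircle) {κ P : ℕ} {s c : ℝ}
    (hs : (s : UnitAddCircle) = κ • θ) (hs0 : 0 < s) (hc : 0 ≤ c) (hcs : c + s ≤ 1 / 2)
    (hP : 1 + s < P * s) :
    ∃ i < P, c < ‖y + i • (κ • θ)‖ ∧ ‖y + i • (κ • θ)‖ ≤ c + s := by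
  obtain ⟨u, hu, hua⟩ := exists_lift_abs_eq_norm y
  obtain ⟨v, hv, hv1, hv2⟩ : ∃ v : ℝ, (v : UnitAddCircle) = y ∧ c - 1 < v ∧ v ≤ c := by
    refine ⟨u + ⌊c - u⌋, ?_, ?_, ?_⟩
    · rw [AddCircle.coe_add, hu, add_eq_left]
      exact (AddCircle.coe_eq_zero_iff (1 : ℝ)).2 ⟨⌊c - u⌋, by simp⟩
    · linarith [Int.lt_floor_add_one (c - u)]
    · linarith [Int.floor_le (c - u)]
  have h1 : (⌊(c - v) / s⌋₊ : ℝ) * s ≤ c - v := by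
    rw [← le_div_iff₀ hs0]; exact Nat.floor_le (div_nonneg (by linarith) hs0.le)
  have h2 : c - v < (⌊(c - v) / s⌋₊ + 1 : ℕ) * s := by
    rw [← div_lt_iff₀ hs0]; exact_mod_cast Nat.lt_floor_add_one _
  have h3 : y + (⌊(c - v) / s⌋₊ + 1) • (κ • θ)
      = ((v + (⌊(c - v) / s⌋₊ + 1 : ℕ) * s : ℝ) : UnitAddCircle) := by
    rw [AddCircle.coe_add, hv, coe_nat_mul, hs]
  have h4 : c < v + (⌊(c - v) / s⌋₊ + 1 : ℕ) * s := by linarith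
  have h5 : v + (⌊(c - v) / s⌋₊ + 1 : ℕ) * s ≤ c + s := by push_cast; linarith
  have h6 : |v + (⌊(c - v) / s⌋₊ + 1 : ℕ) * s| = v + (⌊(c - v) / s⌋₊ + 1 : ℕ) * s :=
    abs_of_nonneg (by linarith)
  refine ⟨⌊(c - v) / s⌋₊ + 1, ?_, ?_⟩
  · have : ((⌊(c - v) / s⌋₊ + 1 : ℕ) : ℝ) * s < P * s := by push_cast; linarith
    exact_mod_cast lt_of_mul_lt_mul_right this hs0.le
  · rw [h3, norm_coe_eq_abs (by rw [h6]; linarith), h6]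
    exact ⟨h4, h5⟩

theorem exists_step_norm_mem_Ioc (θ y : UnitAddCircle) {κ P : ℕ} {s c : ℝ}
    (hs : (s : UnitAddCircle) = κ • θ) (hs0 : 0 < |s|) (hc : 0 ≤ c) (hcs : c + |s| ≤ 1 / 2)
    (hP : 1 + |s| < P * |s|) :
    ∃ i < P, c < ‖y + i • (κ • θ)‖ ∧ ‖y + i • (κ • θ)‖ ≤ c + |s| := by
  rcases le_total 0 s with h | h
  · rw [abs_of_nonneg h] at *
    exact exists_step_norm_mem_Ioc_of_pos θ y hs hs0 hc hcs hP
  · rw [abs_of_nonpos h] at *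
    obtain ⟨i, hi, h'⟩ := exists_step_norm_mem_Ioc_of_pos (-θ) (-y) (κ := κ) (s := -s)
      (by rw [AddCircle.coe_neg, hs, smul_neg]) hs0 hc hcs hP
    refine ⟨i, hi, ?_⟩
    rw [smul_neg, smul_neg, ← neg_add, norm_neg] at h'
    exact h'

/-- Lower bound for the number of `a` in an interval with `a θ - g` in a given shell. -/
theorem le_mul_card_norm_mem_Ioc (θ g : UnitAddCircle) {κ P : ℕ} (M N : ℕ) {s c : ℝ}
    (hs : (s : UnitAddCircle) = κ • θ) (hs0 : 0 < |s|) (hc : 0 ≤ c) (hcs : c + |s| ≤ 1 / 2)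
    (hP : 1 + |s| < P * |s|) :
    N ≤ P * ((Finset.Ico M (M + N + P * κ)).filter fun a : ℕ =>
      c < ‖a • θ - g‖ ∧ ‖a • θ - g‖ ≤ c + |s|).card := by
  set A := (Finset.Ico M (M + N + P * κ)).filter fun a : ℕ =>
      c < ‖a • θ - g‖ ∧ ‖a • θ - g‖ ≤ c + |s|
  choose i hi hi' using fun a : ℕ =>
    exists_step_norm_mem_Ioc θ (a • θ - g) hs hs0 hc hcs hP
  calc N = (Finset.Ico M (M + N)).card := by simp
    _ ≤ (Finset.range P ×ˢ A).card := by
        -- Number of steps and endpoint determine the starting point, so an endpoint is hit at most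
        -- `P` times.
        refine Finset.card_le_card_of_injOn (fun a => (i a, a + i a * κ)) ?_ ?_
        · intro a ha
          rw [Finset.mem_coe, Finset.mem_Ico] at ha
          have h1 : i a * κ ≤ P * κ := Nat.mul_le_mul_right _ (hi a).le
          have h2 : (a + i a * κ) • θ - g = a • θ - g + i a • (κ • θ) := by
            rw [add_smul, mul_smul]; abel
          simp only [Finset.coe_product, Set.mem_prod, Finset.mem_coe, Finset.mem_range, A,
            Finset.mem_filter, Finset.mem_Ico, h2]
          exact ⟨hi a, ⟨by omega, by omega⟩, hi' a⟩
        · intro a _ a' _ h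
          simp only [Prod.mk.injEq] at h
          rw [h.1] at h
          omega
    _ = _ := by simp

/-! ### Moments of the divisor function -/

theorem card_divisors_mul_le (a b : ℕ) :
    (a * b).divisors.card ≤ a.divisors.card * b.divisors.card := by
  rw [Nat.divisors_mul]; exact Finset.card_mul_le

/-- One factor `d(n)` counts the factorisations `n = ab`, and the others satisfy `d(ab) ≤ d(a)d(b)`.
Raising the moment by one thus at most squares the sum, whence the exponent `2^s`. -/
theorem sum_card_divisors_pow_div_le (N s : ℕ) :
    ∑ n ∈ Finset.Icc (1 : ℕ) N, (n.divisors.card : ℝ) ^ s / n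
      ≤ (∑ n ∈ Finset.Icc (1 : ℕ) N, 1 / (n : ℝ)) ^ 2 ^ s := by
  induction s with
  | zero => simp
  | succ s ih =>
    set F : ℕ → ℝ := fun n => (n.divisors.card : ℝ) ^ s / n with hF
    have hF0 : ∀ n, 0 ≤ F n := fun n => by positivity
    calc ∑ n ∈ Finset.Icc (1 : ℕ) N, (n.divisors.card : ℝ) ^ (s + 1) / n
        ≤ ∑ n ∈ Finset.Icc (1 : ℕ) N, ∑ p ∈ n.divisorsAntidiagonal, F p.1 * F p.2 := by
          refine Finset.sum_le_sum fun n _ => ?_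
          have h1 : (n.divisors.card : ℝ) ^ (s + 1) / n
              = ∑ p ∈ n.divisorsAntidiagonal, (n.divisors.card : ℝ) ^ s / n := by
            rw [Finset.sum_const, nsmul_eq_mul, ← Nat.map_div_right_divisors, Finset.card_map,
              pow_succ]
            ring
          rw [h1]
          refine Finset.sum_le_sum fun p hp => ?_
          obtain ⟨rfl, hn⟩ := Nat.mem_divisorsAntidiagonal.1 hp
          have h2 : ((p.1 * p.2).divisors.card : ℝ) ≤ p.1.divisors.card * p.2.divisors.card := by
            exact_mod_cast card_divisors_mul_le _ _
          calc ((p.1 * p.2).divisors.card : ℝ) ^ s / ((p.1 * p.2 : ℕ) : ℝ)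
              ≤ ((p.1.divisors.card : ℝ) * p.2.divisors.card) ^ s / ((p.1 * p.2 : ℕ) : ℝ) := by
                gcongr
            _ = F p.1 * F p.2 := by
                simp only [hF]; push_cast; rw [mul_pow, mul_div_mul_comm]
      _ = ∑ p ∈ (Finset.Icc 1 N).biUnion fun n => n.divisorsAntidiagonal, F p.1 * F p.2 := by
          rw [Finset.sum_biUnion]
          intro m _ n _ hmn
          rw [Function.onFun, Finset.disjoint_left]
          intro p hp hp'
          exact hmn ((Nat.mem_divisorsAntidiagonal.1 hp).1.symm.trans
            (Nat.mem_divisorsAntidiagonal.1 hp').1)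
      _ ≤ ∑ p ∈ Finset.Icc 1 N ×ˢ Finset.Icc 1 N, F p.1 * F p.2 := by
          refine Finset.sum_le_sum_of_subset_of_nonneg ?_
            fun p _ _ => mul_nonneg (hF0 _) (hF0 _)
          intro p hp
          obtain ⟨n, hn, hp⟩ := Finset.mem_biUnion.1 hp
          obtain ⟨rfl, h0⟩ := Nat.mem_divisorsAntidiagonal.1 hp
          rw [Finset.mem_Icc] at hn
          have ha : 0 < p.1 := Nat.pos_of_ne_zero (left_ne_zero_of_mul h0)
          have hb : 0 < p.2 := Nat.pos_of_ne_zero (right_ne_zero_of_mul h0)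
          rw [Finset.mem_product, Finset.mem_Icc, Finset.mem_Icc]
          exact ⟨⟨ha, (Nat.le_mul_of_pos_right _ hb).trans hn.2⟩,
            ⟨hb, (Nat.le_mul_of_pos_left _ ha).trans hn.2⟩⟩
      _ = (∑ n ∈ Finset.Icc (1 : ℕ) N, F n) ^ 2 := by
          rw [sq, Finset.sum_mul_sum, Finset.sum_product]
      _ ≤ ((∑ n ∈ Finset.Icc (1 : ℕ) N, 1 / (n : ℝ)) ^ 2 ^ s) ^ 2 := by
          exact pow_le_pow_left₀ (Finset.sum_nonneg fun n _ => hF0 n) ih 2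
      _ = _ := by rw [← pow_mul, pow_succ]

theorem sum_one_div_two_pow_le (k : ℕ) :
    ∑ n ∈ Finset.Icc (1 : ℕ) (2 ^ k), 1 / (n : ℝ) ≤ k + 1 := by
  have h := harmonic_le_one_add_log (2 ^ k)
  rw [harmonic_eq_sum_Icc] at h
  push_cast at h
  rw [Real.log_pow] at h
  have h2 : Real.log 2 ≤ 1 := by linarith [Real.log_two_lt_d9]
  have h3 : (k : ℝ) * Real.log 2 ≤ k * 1 := by gcongr
  simp only [one_div]
  linarith

/-- Integers with many divisors are rare. -/
theorem card_many_divisors_mul_le (k t s : ℕ) :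
    (((Finset.Ico (2 ^ k) (2 ^ (k + 1))).filter fun n : ℕ => 2 ^ t < n.divisors.card).card : ℝ)
      * (2 ^ t) ^ s ≤ 2 ^ (k + 1) * ((k : ℝ) + 2) ^ 2 ^ s := by
  set B := (Finset.Ico (2 ^ k) (2 ^ (k + 1))).filter fun n : ℕ => 2 ^ t < n.divisors.card
  have hB : ∀ n ∈ B, 1 ≤ n ∧ n ≤ 2 ^ (k + 1) ∧ 2 ^ t ≤ n.divisors.card := by
    intro n hn
    rw [Finset.mem_filter, Finset.mem_Ico] at hn
    exact ⟨Nat.one_le_two_pow.trans hn.1.1, hn.1.2.le, hn.2.le⟩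
  -- Markov's inequality for the moment weighted by `1/n`.
  have h1 : ∑ n ∈ B, ((2 : ℝ) ^ t) ^ s / 2 ^ (k + 1)
      ≤ ∑ n ∈ Finset.Icc (1 : ℕ) (2 ^ (k + 1)), (n.divisors.card : ℝ) ^ s / n := by
    calc _ ≤ ∑ n ∈ B, (n.divisors.card : ℝ) ^ s / n := by
          refine Finset.sum_le_sum fun n hn => ?_
          obtain ⟨h1, h2, h3⟩ := hB n hn
          have h2' : (n : ℝ) ≤ 2 ^ (k + 1) := by exact_mod_cast h2
          have h3' : (2 : ℝ) ^ t ≤ n.divisors.card := by exact_mod_cast h3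
          have h1' : (0 : ℝ) < n := by exact_mod_cast h1
          gcongr
      _ ≤ _ := by
          refine Finset.sum_le_sum_of_subset_of_nonneg ?_ fun n _ _ => by positivity
          intro n hn
          obtain ⟨h1, h2, h3⟩ := hB n hn
          exact Finset.mem_Icc.2 ⟨h1, h2⟩
  rw [Finset.sum_const, nsmul_eq_mul] at h1
  have h2 := h1.trans (sum_card_divisors_pow_div_le (2 ^ (k + 1)) s)
  have h3 : (∑ n ∈ Finset.Icc (1 : ℕ) (2 ^ (k + 1)), 1 / (n : ℝ)) ^ 2 ^ s ≤ ((k : ℝ) + 2) ^ 2 ^ s := by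
    refine pow_le_pow_left₀ (Finset.sum_nonneg fun n _ => by positivity) ?_ _
    have := sum_one_div_two_pow_le (k + 1)
    push_cast at this
    linarith
  have h4 := h2.trans h3
  rw [← mul_div_assoc, div_le_iff₀ (by positivity)] at h4
  linarith

/-! ### The sets `nearSet`: measures and intersections -/

/-- The points of the circle whose `q`-th multiple lies within `r` of `γ`. -/
def nearSet (γ : UnitAddCircle) (q : ℕ) (r : ℝ) : Set UnitAddCircle := {x | ‖q • x - γ‖ < r}

theorem measurableSet_nearSet (γ : UnitAddCircle) (q : ℕ) (r : ℝ) :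
    MeasurableSet (nearSet γ q r) :=
  (isOpen_lt (by fun_prop) continuous_const).measurableSet

theorem measurePreserving_nsmul_unitAddCircle {q : ℕ} (hq : 1 ≤ q) :
    MeasurePreserving (fun x : UnitAddCircle => q • x) volume volume := by
  rcases hq.eq_or_lt with rfl | h
  · simp only [one_smul]; exact MeasurePreserving.id volume
  · exact (AddCircle.ergodic_nsmul h).toMeasurePreserving

theorem volume_real_nearSet (γ : UnitAddCircle) {q : ℕ} (hq : 1 ≤ q) {r : ℝ} (hr : 0 ≤ r)
    (hr' : r ≤ 1 / 2) : volume.real (nearSet γ q r) = 2 * r := by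
  have h1 : nearSet γ q r = (fun x : UnitAddCircle => q • x) ⁻¹' Metric.ball γ r := by
    ext x; simp [nearSet, dist_eq_norm]
  rw [h1, Measure.real, (measurePreserving_nsmul_unitAddCircle hq).measure_preimage
    Metric.isOpen_ball.measurableSet.nullMeasurableSet,
    ← measure_congr AddCircle.closedBall_ae_eq_ball, AddCircle.volume_closedBall,
    min_eq_right (by linarith), ENNReal.toReal_ofReal (by linarith)]

/-- With `z i` the nearest integer, `i ↦ a i - b z i` is injective because `a` is invertible modulo
`b`, and it takes integer values in an open interval of length `2rb`. -/
theorem card_norm_add_lt_le (y : UnitAddCircle) {a b : ℕ} (hb : 0 < b) (hab : a.Coprime b)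
    {r : ℝ} (hr : 0 ≤ r) :
    (((Finset.range b).filter fun i : ℕ =>
      ‖y + ((a * i / b : ℝ) : UnitAddCircle)‖ < r).card : ℝ) ≤ 2 * r * b + 1 := by
  set A := (Finset.range b).filter fun i : ℕ => ‖y + ((a * i / b : ℝ) : UnitAddCircle)‖ < r
  have hb' : (0 : ℝ) < b := by exact_mod_cast hb
  obtain ⟨v, rfl⟩ := QuotientAddGroup.mk_surjective y
  have h1 : ∀ i : ℕ, ∃ z : ℤ, |v + a * i / b - z|
      = ‖(v : UnitAddCircle) + ((a * i / b : ℝ) : UnitAddCircle)‖ := fun i =>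
    ⟨round (v + a * i / b), by rw [← AddCircle.coe_add, UnitAddCircle.norm_eq]⟩
  choose z hz using h1
  have h2 : A.card ≤ (Finset.Ioc ⌊-(b * v) - b * r⌋ (⌈-(b * v) + b * r⌉ - 1)).card := by
    refine Finset.card_le_card_of_injOn (fun i => (a * i - b * z i : ℤ)) ?_ ?_
    · intro i hi
      have hi' := (Finset.mem_filter.1 hi).2
      replace hi' : |v + a * i / b - z i| < r := by rw [hz]; exact hi'
      rw [abs_lt] at hi'
      have e : (b : ℝ) * (v + a * i / b - z i) = b * v + (a * i - b * z i : ℤ) := by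
        push_cast; field_simp; ring
      have e1 := mul_lt_mul_of_pos_left hi'.1 hb'
      have e2 := mul_lt_mul_of_pos_left hi'.2 hb'
      rw [e] at e1 e2
      simp only [Finset.coe_Ioc, Set.mem_Ioc]
      refine ⟨Int.floor_lt.2 (by linarith), Int.le_sub_one_iff.2 (Int.lt_ceil.2 (by linarith))⟩
    · intro i hi j hj hij
      simp only at hij
      have hi' := Finset.mem_range.1 (Finset.mem_filter.1 hi).1
      have hj' := Finset.mem_range.1 (Finset.mem_filter.1 hj).1
      have h3 : a * i ≡ a * j [MOD b] := by
        rw [← Int.natCast_modEq_iff, Int.modEq_iff_dvd]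
        exact ⟨z j - z i, by push_cast; linarith⟩
      have h4 := Nat.ModEq.cancel_left_of_coprime (by rw [Nat.gcd_comm]; exact hab) h3
      exact Nat.ModEq.eq_of_lt_of_lt h4 hi' hj'
  rw [Int.card_Ioc] at h2
  have h3 : (A.card : ℝ) ≤ ((⌈-(b * v) + b * r⌉ - 1 - ⌊-(b * v) - b * r⌋).toNat : ℝ) := by
    exact_mod_cast h2
  refine h3.trans ?_
  rcases le_total 0 (⌈-(b * v) + b * r⌉ - 1 - ⌊-(b * v) - b * r⌋) with h | h
  · have h4 : ((⌈-(b * v) + b * r⌉ - 1 - ⌊-(b * v) - b * r⌋).toNat : ℝ)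
        = ((⌈-(b * v) + b * r⌉ - 1 - ⌊-(b * v) - b * r⌋ : ℤ) : ℝ) := by
      exact_mod_cast Int.toNat_of_nonneg h
    rw [h4]; push_cast
    linarith [Int.ceil_lt_add_one (-(b * v) + b * r), Int.lt_floor_add_one (-(b * v) - b * r)]
  · rw [Int.toNat_of_nonpos h]
    push_cast; positivity

/-- Rotation by `i/q'` preserves the second set and moves `qx` by `ai/b`, where `a/b` is `q/q'` in
lowest terms. Averaging over `i < b` reduces the bound to counting, for fixed `x`, the `i` that
bring `qx - γ` within `r` of zero: at most `2rb + 1`. -/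
theorem volume_real_nearSet_inter_le (γ : UnitAddCircle) {q q' : ℕ} (hq' : 1 ≤ q')
    {r r' : ℝ} (hr : 0 ≤ r) (hr0 : 0 ≤ r') (hr' : r' ≤ 1 / 2) :
    volume.real (nearSet γ q r ∩ nearSet γ q' r') ≤ 2 * r' * (2 * r + q.gcd q' / q') := by
  obtain ⟨a, ha⟩ := Nat.gcd_dvd_left q q'
  obtain ⟨b, hb⟩ := Nat.gcd_dvd_right q q'
  have hd : 0 < q.gcd q' := Nat.gcd_pos_of_pos_right _ hq'
  have hb0 : 0 < b := Nat.pos_of_ne_zero (by rintro rfl; simp at hb; omega)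
  have hab : a.Coprime b := by
    have h := Nat.coprime_div_gcd_div_gcd hd
    rwa [show q / q.gcd q' = a from Nat.div_eq_of_eq_mul_right hd ha,
      show q' / q.gcd q' = b from Nat.div_eq_of_eq_mul_right hd hb] at h
  set d := q.gcd q'
  have hb' : (0 : ℝ) < b := by exact_mod_cast hb0
  have hd' : (0 : ℝ) < d := by exact_mod_cast hd
  have hq'' : (0 : ℝ) < q' := by exact_mod_cast hq'
  have hbr : (q' : ℝ) = d * b := by exact_mod_cast hb
  have har : (q : ℝ) = d * a := by exact_mod_cast ha
  set E := nearSet γ q r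
  set E' := nearSet γ q' r'
  let v : ℕ → UnitAddCircle := fun i => ((i / q' : ℝ) : UnitAddCircle)
  let A : ℕ → Set UnitAddCircle := fun i => (fun x => x + v i) ⁻¹' E
  have hA : ∀ i, MeasurableSet (A i) := fun i =>
    (measurable_add_const (v i)) (measurableSet_nearSet γ q r)
  have hv' : ∀ i, q' • v i = 0 := by
    intro i
    rw [← coe_nat_mul, mul_div_cancel₀ _ hq''.ne', AddCircle.coe_eq_zero_iff]
    exact ⟨i, by simp⟩
  have hv : ∀ i, q • v i = ((a * i / b : ℝ) : UnitAddCircle) := by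
    intro i
    rw [← coe_nat_mul, har, hbr]
    congr 1
    field_simp
  have h1 : ∀ i, volume.real (E ∩ E') = volume.real (A i ∩ E') := by
    intro i
    have e1 : A i ∩ E' = (fun x => x + v i) ⁻¹' (E ∩ E') := by
      ext x
      simp only [A, E', nearSet, Set.mem_inter_iff, Set.mem_preimage, Set.mem_ofPred_eq, smul_add,
        hv', add_zero]
    rw [e1, Measure.real, Measure.real, (measurePreserving_add_right volume (v i)).measure_preimage
      ((measurableSet_nearSet γ q r).inter (measurableSet_nearSet γ q' r')).nullMeasurableSet]
  have h2 : (b : ℝ) * volume.real (E ∩ E') ≤ (2 * r * b + 1) * (2 * r') := by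
    calc (b : ℝ) * volume.real (E ∩ E') = ∑ i ∈ Finset.range b, volume.real (A i ∩ E') := by
          rw [Finset.sum_congr rfl fun i _ => (h1 i).symm]; simp
      _ = ∑ i ∈ Finset.range b, ∫ x in E', (A i).indicator 1 x := by
          refine Finset.sum_congr rfl fun i _ => ?_
          rw [integral_indicator_one (hA i), measureReal_restrict_apply (hA i)]
      _ = ∫ x in E', ∑ i ∈ Finset.range b, (A i).indicator (1 : UnitAddCircle → ℝ) x := by
          rw [integral_finsetSum]
          intro i _
          exact (integrable_const (1 : ℝ)).indicator (hA i)
      _ ≤ ∫ x in E', (2 * r * b + 1) := by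
          refine integral_mono_of_nonneg ?_ (integrable_const _) ?_
          · exact Filter.Eventually.of_forall fun x => Finset.sum_nonneg fun i _ =>
              Set.indicator_nonneg (fun _ _ => zero_le_one) x
          · refine Filter.Eventually.of_forall fun x => ?_
            have e1 := card_norm_add_lt_le (q • x - γ) hb0 hab hr
            rw [Finset.card_filter] at e1
            push_cast at e1
            refine le_trans (le_of_eq (Finset.sum_congr rfl fun i _ => ?_)) e1
            have e2 : x ∈ A i ↔ ‖q • x - γ + ((a * i / b : ℝ) : UnitAddCircle)‖ < r := by
              simp only [A, E, nearSet, Set.mem_preimage, Set.mem_ofPred_eq, smul_add, hv]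
              rw [add_sub_right_comm]
            classical
            rw [Set.indicator_apply]
            simp only [e2, Pi.one_apply]
      _ = (2 * r * b + 1) * (2 * r') := by
          rw [setIntegral_const, volume_real_nearSet γ hq' hr0 hr', smul_eq_mul, mul_comm]
  have h3 : (d : ℝ) / q' = 1 / b := by rw [hbr]; field_simp
  rw [h3]
  have h4 : 2 * r' * (2 * r + 1 / b) = (2 * r * b + 1) * (2 * r') / b := by field_simp
  rw [h4, le_div_iff₀ hb']
  linarith

/-- Eliminating `x` from the two inequalities leaves a condition on `γ` alone. -/
theorem norm_sub_nsmul_lt_of_mem_inter {γ x : UnitAddCircle} {d a b : ℕ} {r r' : ℝ}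
    (ha : 0 < a) (hab : a ≤ b) (hx : x ∈ nearSet γ (d * a) r ∩ nearSet γ (d * b) r') :
    ‖(b - a) • γ‖ < a * r' + b * r := by
  obtain ⟨h1, h2⟩ := hx
  simp only [nearSet, Set.mem_ofPred_eq] at h1 h2
  have e : (b - a) • γ = a • ((d * b) • x - γ) - b • ((d * a) • x - γ) := by
    obtain ⟨c, rfl⟩ := Nat.exists_eq_add_of_le hab
    rw [Nat.add_sub_cancel_left, smul_sub, smul_sub, smul_smul, smul_smul,
      show a * (d * (a + c)) = (a + c) * (d * a) by ring, add_smul a c γ]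
    abel
  have hb : 0 < b := ha.trans_le hab
  have ha' : (0 : ℝ) < a := by exact_mod_cast ha
  have hb' : (0 : ℝ) < b := by exact_mod_cast hb
  rw [e]
  calc _ ≤ ‖a • ((d * b) • x - γ)‖ + ‖b • ((d * a) • x - γ)‖ := norm_sub_le _ _
    _ ≤ a * ‖(d * b) • x - γ‖ + b * ‖(d * a) • x - γ‖ :=
        add_le_add (norm_nsmul_le) (norm_nsmul_le)
    _ < _ := by gcongr

/-! ### The second moment argument -/

/-- A second moment bound for the number of `q` in a finite set with `x` in `nearSet γ q (r q)`. -/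
theorem sum_volume_real_nearSet_inter_le (γ : UnitAddCircle) (r : ℕ → ℝ) (hr0 : ∀ q, 0 ≤ r q)
    (hr : ∀ q, r q ≤ 1 / 2) (C : ℝ)
    (hC : ∀ q' : ℕ, 1 ≤ q' → 0 < r q' → ∀ s ⊆ Finset.Icc 1 q',
      (∀ q ∈ s, (nearSet γ q (r q) ∩ nearSet γ q' (r q')).Nonempty) →
      ∑ q ∈ s, (q.gcd q' : ℝ) / q' ≤ C) {n N : ℕ} (hn : 1 ≤ n) :
    ∑ q ∈ Finset.Icc n N, ∑ q' ∈ Finset.Icc n N,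
      volume.real (nearSet γ q (r q) ∩ nearSet γ q' (r q'))
      ≤ (∑ q ∈ Finset.Icc n N, 2 * r q) ^ 2 + 2 * C * ∑ q ∈ Finset.Icc n N, 2 * r q := by
  classical
  set I := Finset.Icc n N
  have hI : ∀ q ∈ I, 1 ≤ q := fun q hq => hn.trans (Finset.mem_Icc.1 hq).1
  set E : ℕ → Set UnitAddCircle := fun q => nearSet γ q (r q)
  -- The excess over independence, charged to the larger index and zero for disjoint sets, so that
  -- `hC` bounds its sum.
  let e : ℕ → ℕ → ℝ := fun q q' =>
    if q ≤ q' ∧ (E q ∩ E q').Nonempty then 2 * r q' * ((q.gcd q' : ℝ) / q') else 0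
  have he0 : ∀ q q', 0 ≤ e q q' := by
    intro q q'
    simp only [e]
    split_ifs
    · have := hr0 q'; positivity
    · exact le_rfl
  have h1 : ∀ q ∈ I, ∀ q' ∈ I, q ≤ q' →
      volume.real (E q ∩ E q') ≤ 2 * r q * (2 * r q') + e q q' := by
    intro q hq q' hq' hqq
    by_cases hne : (E q ∩ E q').Nonempty
    · simp only [e, if_pos (And.intro hqq hne)]
      refine (volume_real_nearSet_inter_le γ (hI q' hq') (hr0 q) (hr0 q') (hr q')).trans
        (le_of_eq ?_)
      ring
    · rw [Set.not_nonempty_iff_eq_empty] at hne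
      rw [hne, measureReal_empty]
      have := hr0 q; have := hr0 q'; have := he0 q q'
      positivity
  have h2 : ∀ q ∈ I, ∀ q' ∈ I,
      volume.real (E q ∩ E q') ≤ 2 * r q * (2 * r q') + e q q' + e q' q := by
    intro q hq q' hq'
    rcases le_total q q' with h | h
    · linarith [h1 q hq q' hq' h, he0 q' q]
    · have := h1 q' hq' q hq h
      rw [Set.inter_comm] at this
      linarith [he0 q q']
  have h3 : ∀ q' ∈ I, ∑ q ∈ I, e q q' ≤ C * (2 * r q') := by
    intro q' hq'
    rcases (hr0 q').eq_or_lt with h0 | h0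
    · simp [e, ← h0]
    · simp only [e]
      rw [← Finset.sum_filter, ← Finset.mul_sum, mul_comm]
      refine mul_le_mul_of_nonneg_right ?_ (by linarith)
      refine hC q' (hI q' hq') h0 _ ?_ ?_
      · intro q hq
        rw [Finset.mem_filter] at hq
        exact Finset.mem_Icc.2 ⟨hI q hq.1, hq.2.1⟩
      · intro q hq
        exact (Finset.mem_filter.1 hq).2.2
  calc ∑ q ∈ I, ∑ q' ∈ I, volume.real (E q ∩ E q')
      ≤ ∑ q ∈ I, ∑ q' ∈ I, (2 * r q * (2 * r q') + e q q' + e q' q) :=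
        Finset.sum_le_sum fun q hq => Finset.sum_le_sum fun q' hq' => h2 q hq q' hq'
    _ = (∑ q ∈ I, 2 * r q) ^ 2 + ∑ q' ∈ I, ∑ q ∈ I, e q q' + ∑ q' ∈ I, ∑ q ∈ I, e q q' := by
        simp only [Finset.sum_add_distrib]
        rw [sq, Finset.sum_mul_sum, Finset.sum_comm (f := fun q q' => e q q')]
    _ ≤ (∑ q ∈ I, 2 * r q) ^ 2 + ∑ q' ∈ I, C * (2 * r q') + ∑ q' ∈ I, C * (2 * r q') := by
        gcongr with q' hq' q' hq'
        · exact h3 q' hq'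
        · exact h3 q' hq'
    _ = _ := by rw [← Finset.mul_sum I (fun q => 2 * r q) C]; ring

/-- Let `f` count the sets with index in `[n, N]` containing `x`, with mean `M`. On the set `B`
missed by all indices from `n` on, `(f - M)^2 = M^2`, whereas the variance is at most `2CM`. Hence
`|B| M ≤ 2|C|`, impossible for large `M` unless `B` is null. -/
theorem ae_infinite_mem_nearSet (γ : UnitAddCircle) (r : ℕ → ℝ) (hr0 : ∀ q, 0 ≤ r q)
    (hr : ∀ q, r q ≤ 1 / 2) (C : ℝ)
    (hC : ∀ q' : ℕ, 1 ≤ q' → 0 < r q' → ∀ s ⊆ Finset.Icc 1 q',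
      (∀ q ∈ s, (nearSet γ q (r q) ∩ nearSet γ q' (r q')).Nonempty) →
      ∑ q ∈ s, (q.gcd q' : ℝ) / q' ≤ C)
    (hdiv : Filter.Tendsto (fun N : ℕ => ∑ q ∈ Finset.Icc 1 N, r q) Filter.atTop Filter.atTop) :
    ∀ᵐ x : UnitAddCircle, {q : ℕ | 1 ≤ q ∧ x ∈ nearSet γ q (r q)}.Infinite := by
  have key : ∀ n : ℕ, 1 ≤ n → ∀ᵐ x : UnitAddCircle, ∃ q, n ≤ q ∧ x ∈ nearSet γ q (r q) := by
    intro n hn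
    set E : ℕ → Set UnitAddCircle := fun q => nearSet γ q (r q)
    have hE : ∀ q, MeasurableSet (E q) := fun q => measurableSet_nearSet γ q (r q)
    set B : Set UnitAddCircle := {x | ¬ ∃ q, n ≤ q ∧ x ∈ E q} with hBdef
    have hB : MeasurableSet B := by
      have : B = (⋃ q : ℕ, ⋃ _ : n ≤ q, E q)ᶜ := by ext x; simp [B]
      rw [this]
      exact (MeasurableSet.iUnion fun q => MeasurableSet.iUnion fun _ => hE q).compl
    rw [ae_iff]
    change volume B = 0
    by_contra hne
    have hpos : 0 < volume.real B := ENNReal.toReal_pos hne (measure_ne_top _ _)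
    -- `N` is taken so large that `|B| M` exceeds `2|C|`.
    obtain ⟨N, hN⟩ := (hdiv.eventually_ge_atTop
      (∑ q ∈ Finset.Ico 1 n, r q + (|C| / volume.real B + 1))).exists
    set I := Finset.Icc n N
    set M := ∑ q ∈ I, 2 * r q with hM
    have hMlarge : 2 * (|C| / volume.real B + 1) ≤ M := by
      have h1 : ∑ q ∈ Finset.Icc 1 N, r q ≤ ∑ q ∈ Finset.Ico 1 n, r q + ∑ q ∈ I, r q := by
        rw [← Finset.sum_union]
        · refine Finset.sum_le_sum_of_subset_of_nonneg ?_ fun q _ _ => hr0 q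
          intro q hq
          simp only [I, Finset.mem_union, Finset.mem_Ico, Finset.mem_Icc] at hq ⊢
          omega
        · rw [Finset.disjoint_left]
          intro q hq hq'
          simp only [I, Finset.mem_Ico, Finset.mem_Icc] at hq hq'
          omega
      rw [hM, ← Finset.mul_sum]
      linarith
    have hMpos : 0 < M := by have : 0 ≤ |C| / volume.real B := by positivity
                             linarith
    set f : UnitAddCircle → ℝ := fun x => ∑ q ∈ I, (E q).indicator 1 x with hf
    have hint : ∀ q, Integrable ((E q).indicator (1 : UnitAddCircle → ℝ)) volume := fun q =>
      (integrable_const (1 : ℝ)).indicator (hE q)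
    have hint2 : ∀ q q', Integrable ((E q ∩ E q').indicator (1 : UnitAddCircle → ℝ)) volume :=
      fun q q' => (integrable_const (1 : ℝ)).indicator ((hE q).inter (hE q'))
    have hfi : Integrable f volume := integrable_finsetSum _ fun q _ => hint q
    have hfM : ∫ x, f x = M := by
      rw [hf, integral_finsetSum _ fun q _ => hint q]
      refine Finset.sum_congr rfl fun q hq => ?_
      rw [integral_indicator_one (hE q)]
      exact volume_real_nearSet γ (hn.trans (Finset.mem_Icc.1 hq).1) (hr0 q) (hr q)
    have hf2 : ∀ x, f x ^ 2
        = ∑ q ∈ I, ∑ q' ∈ I, (E q ∩ E q').indicator (1 : UnitAddCircle → ℝ) x := by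
      intro x
      simp only [hf]
      rw [sq, Finset.sum_mul_sum]
      refine Finset.sum_congr rfl fun q _ => Finset.sum_congr rfl fun q' _ => ?_
      rw [Set.inter_indicator_one, Pi.mul_apply]
    have hf2i : Integrable (fun x => f x ^ 2) volume := by
      simp only [hf2]
      exact integrable_finsetSum _ fun q _ => integrable_finsetSum _ fun q' _ => hint2 q q'
    have hf2M : ∫ x, f x ^ 2 ≤ M ^ 2 + 2 * C * M := by
      simp only [hf2]
      rw [integral_finsetSum _ fun q _ => integrable_finsetSum _ fun q' _ => hint2 q q']
      refine le_trans (le_of_eq ?_) (sum_volume_real_nearSet_inter_le γ r hr0 hr C hC hn)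
      refine Finset.sum_congr rfl fun q _ => ?_
      rw [integral_finsetSum _ fun q' _ => hint2 q q']
      refine Finset.sum_congr rfl fun q' _ => ?_
      rw [integral_indicator_one ((hE q).inter (hE q'))]
    have hexp : ∀ x, (f x - M) ^ 2 = f x ^ 2 - 2 * M * f x + M ^ 2 := fun x => by ring
    have hsub : Integrable (fun x => f x ^ 2 - 2 * M * f x) volume :=
      hf2i.sub (hfi.const_mul _)
    have hvi : Integrable (fun x => (f x - M) ^ 2) volume := by
      simp only [hexp]
      exact hsub.add (integrable_const _)
    have hvar : ∫ x, (f x - M) ^ 2 ≤ 2 * C * M := by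
      simp only [hexp]
      rw [integral_add hsub (integrable_const _),
        integral_sub hf2i (hfi.const_mul _), integral_const_mul, hfM, integral_const]
      simp only [smul_eq_mul]
      have : volume.real (Set.univ : Set UnitAddCircle) = 1 := by
        simp [Measure.real]
      rw [this]
      linarith
    have hlow : volume.real B * M ^ 2 ≤ ∫ x, (f x - M) ^ 2 := by
      calc volume.real B * M ^ 2 = ∫ x in B, (f x - M) ^ 2 := by
            rw [setIntegral_congr_fun (g := fun _ => M ^ 2) hB, setIntegral_const, smul_eq_mul]
            intro x hx
            have : f x = 0 := by
              refine Finset.sum_eq_zero fun q hq => Set.indicator_of_notMem ?_ _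
              exact fun hxq => hx ⟨q, (Finset.mem_Icc.1 hq).1, hxq⟩
            simp [this]
        _ ≤ _ := setIntegral_le_integral hvi (Filter.Eventually.of_forall fun x => sq_nonneg _)
    have h1 : volume.real B * M ≤ 2 * |C| := by
      have : volume.real B * M * M ≤ 2 * |C| * M := by
        have : 2 * C * M ≤ 2 * |C| * M := by
          have := le_abs_self C
          gcongr
        nlinarith
      exact le_of_mul_le_mul_right this hMpos
    have h2 : volume.real B * (2 * (|C| / volume.real B + 1)) ≤ volume.real B * M := by gcongr
    have h3 : volume.real B * (2 * (|C| / volume.real B + 1)) = 2 * |C| + 2 * volume.real B := by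
      field_simp
    linarith
  have hall : ∀ᵐ x : UnitAddCircle, ∀ n : ℕ, 1 ≤ n → ∃ q, n ≤ q ∧ x ∈ nearSet γ q (r q) := by
    rw [ae_all_iff]
    intro n
    by_cases hn : 1 ≤ n
    · filter_upwards [key n hn] with x hx _ using hx
    · exact Filter.Eventually.of_forall fun x h => absurd h hn
  filter_upwards [hall] with x hx
  rw [← Nat.frequently_atTop_iff_infinite, Filter.frequently_atTop]
  intro n
  obtain ⟨q, hq, hqx⟩ := hx (max n 1) (le_max_right _ _)
  exact ⟨q, (le_max_left _ _).trans hq, (le_max_right _ _).trans hq, hqx⟩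

/-! ### Gcd sums and counting under Diophantine lower bounds -/

/-- A term with gcd `d` has weight `d/q' = 1/b`, so each class contributes at most `K/2^t`, and
there are at most `2^t` classes. The extra `1` is the term `q = q'`. -/
theorem sum_gcd_div_le {q' t : ℕ} (hq' : 1 ≤ q') (ht : q'.divisors.card ≤ 2 ^ t) {K : ℝ}
    (hK : 0 ≤ K) {s : Finset ℕ} (hs : s ⊆ Finset.Icc 1 q')
    (H : ∀ d b : ℕ, q' = d * b →
      ((s.filter fun q => q.gcd q' = d ∧ q < q').card : ℝ) ≤ K * b / 2 ^ t) :
    ∑ q ∈ s, (q.gcd q' : ℝ) / q' ≤ K + 1 := by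
  have hq0 : (0 : ℝ) < q' := by exact_mod_cast hq'
  have h1 : ∑ q ∈ s.filter (fun q => q < q'), (q.gcd q' : ℝ) / q' ≤ K := by
    calc ∑ q ∈ s.filter (fun q => q < q'), (q.gcd q' : ℝ) / q'
        = ∑ d ∈ q'.divisors, ∑ q ∈ (s.filter fun q => q < q').filter (fun q => q.gcd q' = d),
            (q.gcd q' : ℝ) / q' := by
          rw [Finset.sum_fiberwise_of_maps_to]
          intro q _
          exact Nat.mem_divisors.2 ⟨Nat.gcd_dvd_right q q', by omega⟩
      _ ≤ ∑ d ∈ q'.divisors, K / 2 ^ t := by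
          refine Finset.sum_le_sum fun d hd => ?_
          obtain ⟨b, hb⟩ := (Nat.mem_divisors.1 hd).1
          have e1 : ∑ q ∈ (s.filter fun q => q < q').filter (fun q => q.gcd q' = d),
              (q.gcd q' : ℝ) / q'
              = ((s.filter fun q => q.gcd q' = d ∧ q < q').card : ℝ) * (d / q') := by
            rw [Finset.filter_filter, Finset.filter_congr (fun q _ => and_comm), ← nsmul_eq_mul,
              ← Finset.sum_const]
            refine Finset.sum_congr rfl fun q hq => ?_
            rw [(Finset.mem_filter.1 hq).2.1]
          have hbr : (q' : ℝ) = d * b := by exact_mod_cast hb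
          have hd0 : (d : ℝ) ≠ 0 := by rintro h; rw [hbr, h] at hq0; simp at hq0
          have hb0 : (b : ℝ) ≠ 0 := by rintro h; rw [hbr, h] at hq0; simp at hq0
          rw [e1]
          calc _ ≤ (K * b / 2 ^ t) * (d / q') := by
                gcongr; exact H d b hb
            _ = K / 2 ^ t := by rw [hbr]; field_simp
      _ = q'.divisors.card * (K / 2 ^ t) := by simp
      _ ≤ 2 ^ t * (K / 2 ^ t) := by
          gcongr; exact_mod_cast ht
      _ = K := by field_simp
  have h2 : ∑ q ∈ s.filter (fun q => ¬ q < q'), (q.gcd q' : ℝ) / q' ≤ 1 := by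
    calc _ ≤ ∑ q ∈ {q'}, (q.gcd q' : ℝ) / q' := by
          refine Finset.sum_le_sum_of_subset_of_nonneg ?_ fun q _ _ => by positivity
          intro q hq
          rw [Finset.mem_filter] at hq
          have := (Finset.mem_Icc.1 (hs hq.1)).2
          rw [Finset.mem_singleton]; omega
      _ = 1 := by simp [hq0.ne']
  rw [← Finset.sum_filter_add_sum_filter_not s (fun q => q < q')]
  linarith

/-- The multiples `n x` with `n ≤ 2 ^ e` and `e ≤ k` are at least `2 ^ (-(e + 1) w - 1)` away from
zero. -/
def FarMultiples (x : UnitAddCircle) (w k : ℕ) : Prop :=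
  ∀ e ≤ k, ∀ n : ℕ, 1 ≤ n → n ≤ 2 ^ e → (1 / 2 : ℝ) ^ ((e + 1) * w + 1) ≤ ‖n • x‖

/-- Dirichlet's theorem for `d • x` yields a step of size between `2^(1-t)` and `2^(2-t)`, and the
lower bound at level `t + g` keeps its index `κ` below `b/2^t`. Then `card_norm_sub_le` with `T =
2^(t-3)` gives `8(b + b/8)/2^t`. -/
theorem FarMultiples.card_norm_nsmul_sub_le {x : UnitAddCircle} {w k : ℕ}
    (hx : FarMultiples x w k) (y : UnitAddCircle) {t g d b : ℕ} (ht : 3 ≤ t) (hd : 1 ≤ d)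
    (hdg : d ≤ 2 ^ g) (hk : (t + g + 1) * w + 3 + t + g ≤ k) (hdb : 2 ^ k ≤ d * b) :
    (((Finset.range b).filter fun a : ℕ => ‖a • (d • x) - y‖ ≤ (1 / 2 : ℝ) ^ t).card : ℝ)
      ≤ 9 * b / 2 ^ t := by
  set A := (Finset.range b).filter fun a : ℕ => ‖a • (d • x) - y‖ ≤ (1 / 2 : ℝ) ^ t
  have e0 : (1 / 2 : ℝ) ^ t * 2 ^ t = 1 := by rw [← mul_pow]; norm_num
  obtain ⟨κ, s, -, hκ, hs, hs1, hs2⟩ := exists_nsmul_norm_mem_Ioc (d • x) (n := 2 ^ t)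
    (δ := 2 * (1 / 2 : ℝ) ^ t) (η := (1 / 2 : ℝ) ^ ((t + g + 1) * w + 1)) (by positivity)
    (by push_cast
        nlinarith [show (0 : ℝ) < (1 / 2) ^ t by positivity])
    (by positivity) (fun i hi hi' => by
      rw [smul_smul]
      refine hx (t + g) (by omega) (i * d) (Nat.mul_pos hi hd) ?_
      rw [pow_add]; exact Nat.mul_le_mul hi' hdg)
  have hκ' : κ ≤ 2 ^ ((t + g + 1) * w + 3) := by
    have : (κ : ℝ) ≤ 2 ^ ((t + g + 1) * w + 3) := by
      refine hκ.trans (le_of_eq ?_)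
      push_cast
      rw [show (t + g + 1) * w + 3 = ((t + g + 1) * w + 1) + 2 from rfl,
        pow_add (2 : ℝ) ((t + g + 1) * w + 1) 2, one_div_pow, one_div_pow]
      field_simp
    exact_mod_cast this
  have hκb : κ * 2 ^ t ≤ b := by
    have h1 : κ * 2 ^ t * 2 ^ g ≤ b * 2 ^ g := by
      calc κ * 2 ^ t * 2 ^ g ≤ 2 ^ ((t + g + 1) * w + 3) * 2 ^ t * 2 ^ g := by gcongr
        _ = 2 ^ ((t + g + 1) * w + 3 + t + g) := by rw [← pow_add, ← pow_add]
        _ ≤ 2 ^ k := Nat.pow_le_pow_right (by norm_num) hk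
        _ ≤ d * b := hdb
        _ ≤ 2 ^ g * b := by gcongr
        _ = b * 2 ^ g := mul_comm _ _
    exact Nat.le_of_mul_le_mul_right h1 (by positivity)
  obtain ⟨u, rfl⟩ := Nat.exists_eq_add_of_le' ht
  have h2 := card_norm_sub_le (d • x) y b (T := 2 ^ u) hs hs1 (by
    push_cast
    calc (2 : ℝ) ^ u * |s| ≤ 2 ^ u * (2 * (2 * (1 / 2 : ℝ) ^ (u + 3))) := by gcongr
      _ = ((2 : ℝ) ^ u * (1 / 2) ^ u) * (1 / 2) := by ring
      _ ≤ 1 / 2 := by rw [← mul_pow]; norm_num)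
  have h3 : (2 : ℝ) ^ u * A.card ≤ b + 2 ^ u * κ := by exact_mod_cast h2
  have h4 : (κ : ℝ) * 2 ^ (u + 3) ≤ b := by exact_mod_cast hκb
  rw [le_div_iff₀ (by positivity), pow_add]
  rw [pow_add] at h4
  nlinarith

/-- Two such `c` differ by more than `2^t`, since their difference has a multiple shorter than `2ξ`;
each `c` itself exceeds `2^t`, so the shifts `c - i` with `i < 2^t` are distinct and stay in `[0,
b)`. -/
theorem FarMultiples.card_norm_nsmul_lt_le {x : UnitAddCircle} {w k : ℕ}
    (hx : FarMultiples x w k) {t : ℕ} (ht : t ≤ k) {ξ : ℝ}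
    (hξ : 2 * ξ ≤ (1 / 2 : ℝ) ^ ((t + 1) * w + 1)) (b : ℕ) :
    2 ^ t * ((Finset.Ico 1 b).filter fun c : ℕ => ‖c • x‖ < ξ).card ≤ b := by
  set F := (Finset.Ico 1 b).filter fun c : ℕ => ‖c • x‖ < ξ
  have hF : ∀ c ∈ F, 1 ≤ c ∧ c < b ∧ ‖c • x‖ < ξ := fun c hc => by
    rw [Finset.mem_filter, Finset.mem_Ico] at hc
    exact ⟨hc.1.1, hc.1.2, hc.2⟩
  have h1 : ∀ n : ℕ, 1 ≤ n → ‖n • x‖ < 2 * ξ → 2 ^ t < n := by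
    intro n hn h
    by_contra! hnt
    exact absurd (hx t ht n hn hnt) (not_le.2 (h.trans_le hξ))
  have h2 : ∀ c ∈ F, 2 ^ t < c := by
    intro c hc
    obtain ⟨hc1, -, hc3⟩ := hF c hc
    exact h1 c hc1 (by linarith [norm_nonneg (c • x)])
  have h3 : ∀ c ∈ F, ∀ c' ∈ F, c < c' → c + 2 ^ t < c' := by
    intro c hc c' hc' hcc
    obtain ⟨n, rfl⟩ := Nat.exists_eq_add_of_lt hcc
    have h4 : (n + 1) • x = (c + n + 1) • x - c • x := by
      rw [add_assoc, add_smul c]; abel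
    have h5 := h1 (n + 1) (by omega) (by
      rw [h4]
      linarith [norm_sub_le ((c + n + 1) • x) (c • x), (hF _ hc).2.2, (hF _ hc').2.2])
    omega
  calc 2 ^ t * F.card = (Finset.range (2 ^ t) ×ˢ F).card := by simp
    _ ≤ (Finset.range b).card := by
        refine Finset.card_le_card_of_injOn (fun p => p.2 - p.1) ?_ ?_
        · rintro ⟨i, c⟩ h
          simp only [Finset.coe_product, Set.mem_prod, Finset.mem_coe, Finset.mem_range] at h
          simp only [Finset.coe_range, Set.mem_Iio]
          have := (hF c h.2).2.1
          omega
        · rintro ⟨i, c⟩ h ⟨j, c'⟩ h' heq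
          simp only [Finset.coe_product, Set.mem_prod, Finset.mem_coe, Finset.mem_range] at h h'
          simp only at heq
          have e1 := h2 c h.2
          have e2 := h2 c' h'.2
          rcases lt_trichotomy c c' with hc | hc | hc
          · have := h3 c h.2 c' h'.2 hc; omega
          · subst hc; simp only [Prod.mk.injEq, and_true]; omega
          · have := h3 c' h'.2 c h.2 hc; omega
    _ = b := by simp

/-- A step `s` with `2^(-j-2) < |s| ≤ 2^(-j-1)` fits inside the shell, and `2^(j+3)` steps go round
the circle. Starting points fill the first half of the block; `hk` makes the total shift fit in the
second. -/
theorem FarMultiples.le_card_shell {x : UnitAddCircle} {w k : ℕ}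
    (hx : FarMultiples x w k) (y : UnitAddCircle) {j : ℕ} (hj : 1 ≤ j)
    (hk : (j + 3) * w + j + 6 ≤ k) :
    (2 : ℝ) ^ k / 2 ^ (j + 4) ≤ ((Finset.Ico (2 ^ k) (2 ^ (k + 1))).filter fun q : ℕ =>
      (1 / 2 : ℝ) ^ (j + 1) < ‖q • x - y‖ ∧ ‖q • x - y‖ ≤ (1 / 2 : ℝ) ^ j).card := by
  have e0 : (1 / 2 : ℝ) ^ (j + 2) * 2 ^ (j + 2) = 1 := by rw [← mul_pow]; norm_num
  obtain ⟨κ, s, -, hκ, hs, hs1, hs2⟩ := exists_nsmul_norm_mem_Ioc x (n := 2 ^ (j + 2))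
    (δ := (1 / 2 : ℝ) ^ (j + 2)) (η := (1 / 2 : ℝ) ^ ((j + 3) * w + 1)) (by positivity)
    (by push_cast
        nlinarith [show (0 : ℝ) < (1 / 2) ^ (j + 2) by positivity])
    (by positivity) (fun i hi hi' => hx (j + 2) (by nlinarith) i hi hi')
  have hκ' : κ ≤ 2 ^ ((j + 3) * w + 2) := by
    have : (κ : ℝ) ≤ 2 ^ ((j + 3) * w + 2) := by
      refine hκ.trans (le_of_eq ?_)
      push_cast
      rw [show (j + 3) * w + 2 = ((j + 3) * w + 1) + 1 from rfl,
        pow_add (2 : ℝ) ((j + 3) * w + 1) 1, one_div_pow, one_div_pow]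
      field_simp
    exact_mod_cast this
  have hs0 : 0 < |s| := lt_trans (by positivity) hs1
  have hpj : (1 / 2 : ℝ) ^ (j + 1) = 2 * (1 / 2 : ℝ) ^ (j + 2) := by ring
  have hpj' : (1 / 2 : ℝ) ^ j = 2 * (1 / 2 : ℝ) ^ (j + 1) := by ring
  have hpj1 : (1 / 2 : ℝ) ^ j ≤ 1 / 2 := by
    calc (1 / 2 : ℝ) ^ j ≤ (1 / 2 : ℝ) ^ 1 :=
          pow_le_pow_of_le_one (by norm_num) (by norm_num) hj
      _ = 1 / 2 := by norm_num
  obtain ⟨l, rfl⟩ := Nat.exists_eq_add_of_le' (show 1 ≤ k by omega)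
  have h1 := le_mul_card_norm_mem_Ioc x y (P := 2 ^ (j + 3)) (2 ^ (l + 1)) (2 ^ l)
    (c := (1 / 2 : ℝ) ^ (j + 1)) hs hs0 (by positivity) (by linarith) (by
      push_cast
      have e1 : (2 : ℝ) ^ (j + 3) = 2 * 2 ^ (j + 2) := by ring
      have e2 : 1 < (2 : ℝ) ^ (j + 2) * |s| := by
        rw [← e0, mul_comm]; gcongr
      rw [e1, mul_assoc]
      linarith)
  have h2 : 2 ^ (j + 3) * κ ≤ 2 ^ l := by
    calc 2 ^ (j + 3) * κ ≤ 2 ^ (j + 3) * 2 ^ ((j + 3) * w + 2) := by gcongr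
      _ = 2 ^ ((j + 3) * w + j + 5) := by rw [← pow_add]; congr 1; ring
      _ ≤ 2 ^ l := Nat.pow_le_pow_right (by norm_num) (by omega)
  set G := (Finset.Ico (2 ^ (l + 1)) (2 ^ (l + 1 + 1))).filter fun q : ℕ =>
      (1 / 2 : ℝ) ^ (j + 1) < ‖q • x - y‖ ∧ ‖q • x - y‖ ≤ (1 / 2 : ℝ) ^ j
  have h3 : 2 ^ l ≤ 2 ^ (j + 3) * G.card := by
    refine h1.trans (Nat.mul_le_mul_left _ (Finset.card_le_card ?_))
    intro q hq
    rw [Finset.mem_filter, Finset.mem_Ico] at hq ⊢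
    have e1 : 2 ^ (l + 1 + 1) = 2 ^ (l + 1) + 2 ^ l + 2 ^ l := by ring
    refine ⟨⟨hq.1.1, by omega⟩, hq.2.1, hq.2.2.trans (by linarith)⟩
  have h4 : (2 : ℝ) ^ l ≤ 2 ^ (j + 3) * G.card := by exact_mod_cast h3
  rw [div_le_iff₀ (by positivity)]
  have e1 : (2 : ℝ) ^ (j + 4) = 2 * 2 ^ (j + 3) := by ring
  rw [e1, pow_succ]
  linarith

/-! ### Good indices: bounded gcd sums and divergence -/

/-- The inequalities between the three scales attached to the dyadic block `[2 ^ k, 2 ^ (k + 1))`: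
the divisor exponent `t`, the shell exponent `h` and the Diophantine exponent `w`. -/
structure ScaleConditions (t h w : ℕ → ℕ) (k : ℕ) : Prop where
  three_le : 3 ≤ t k
  near : ∀ l ≤ k, k ≤ l + t k → t k ≤ h l ∧ h l ≤ 3 * h k
  small : (t k + 10 * h k + 1) * w k + 3 + t k + 10 * h k ≤ k
  far : (t k + 1) * w k + 1 + t k + 2 + 6 * h k ≤ 10 * h k
  rare : (k + 2) ^ 2 ^ (8 * w k) * 2 ^ (2 * h k + 6) ≤ 2 ^ (t k * (8 * w k))
  size : k ≤ 64 * w k * h k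

/-- The indices `q` kept in the second moment argument: few divisors, and `q β` at a controlled
small distance from `y`. -/
structure GoodIndex (β y : UnitAddCircle) (t h : ℕ → ℕ) (k₀ q : ℕ) : Prop where
  pos : 1 ≤ q
  le_log : k₀ ≤ Nat.log 2 q
  card_divisors_le : q.divisors.card ≤ 2 ^ t (Nat.log 2 q)
  le_norm : (1 / 2 : ℝ) ^ (2 * h (Nat.log 2 q)) ≤ ‖q • β - y‖
  norm_le : ‖q • β - y‖ ≤ (1 / 2 : ℝ) ^ h (Nat.log 2 q)

theorem sum_gcd_div_le_of_goodIndex {γ β y : UnitAddCircle} {t h w : ℕ → ℕ} {k₀ : ℕ}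
    (hsc : ∀ k ≥ k₀, ScaleConditions t h w k) (hγ : ∀ k ≥ k₀, FarMultiples γ (w k) k)
    (hβ : ∀ k ≥ k₀, FarMultiples β (w k) k) {r : ℕ → ℝ}
    (hr : ∀ q, 0 < r q → GoodIndex β y t h k₀ q ∧ r q ≤ 2 ^ (2 * h (Nat.log 2 q)) / q)
    {q' : ℕ} (hq' : 0 < r q') {s : Finset ℕ} (hs : s ⊆ Finset.Icc 1 q')
    (hne : ∀ q ∈ s, (nearSet γ q (r q) ∩ nearSet γ q' (r q')).Nonempty) :
    ∑ q ∈ s, (q.gcd q' : ℝ) / q' ≤ 12 := by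
  obtain ⟨hg, hr'⟩ := hr q' hq'
  have hpos : ∀ q ∈ s, 0 < r q := by
    intro q hq
    obtain ⟨x, hx, -⟩ := hne q hq
    exact (norm_nonneg _).trans_lt hx
  set k := Nat.log 2 q' with hk
  have hq'1 := hg.pos
  have hkq : 2 ^ k ≤ q' := Nat.pow_log_le_self 2 (by omega)
  have hkq' : q' < 2 ^ (k + 1) := Nat.lt_pow_succ_log_self (by norm_num) q'
  have hS := hsc k hg.le_log
  rw [show (12 : ℝ) = 11 + 1 by norm_num]
  refine sum_gcd_div_le hq'1 hg.card_divisors_le (by norm_num) hs fun d b hdb => ?_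
  have hd : 0 < d := Nat.pos_of_ne_zero (by rintro rfl; simp at hdb; omega)
  have hb : 0 < b := Nat.pos_of_ne_zero (by rintro rfl; simp at hdb; omega)
  have hdr : (0 : ℝ) < d := by exact_mod_cast hd
  have hbr : (0 : ℝ) < b := by exact_mod_cast hb
  have h2t : (0 : ℝ) < 2 ^ t k := by positivity
  set F := s.filter fun q => q.gcd q' = d ∧ q < q' with hF
  have hFa : ∀ q ∈ F, ∃ a, q = d * a ∧ q / d = a ∧ 1 ≤ a ∧ a < b ∧ q ∈ s := by
    intro q hq
    obtain ⟨hqs, hgcd, hlt⟩ := Finset.mem_filter.1 hq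
    obtain ⟨a, ha⟩ := Nat.gcd_dvd_left q q'
    rw [hgcd] at ha
    have hq1 := (Finset.mem_Icc.1 (hs hqs)).1
    refine ⟨a, ha, Nat.div_eq_of_eq_mul_right hd ha, ?_, ?_, hqs⟩
    · exact Nat.pos_of_ne_zero (by rintro rfl; simp at ha; omega)
    · rw [ha, hdb] at hlt; exact lt_of_mul_lt_mul_left hlt hd.le
  have hinj : ∀ q₁ ∈ F, ∀ q₂ ∈ F, q₁ / d = q₂ / d → q₁ = q₂ := by
    intro q₁ h₁ q₂ h₂ heq
    obtain ⟨a₁, e₁, f₁, -⟩ := hFa q₁ h₁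
    obtain ⟨a₂, e₂, f₂, -⟩ := hFa q₂ h₂
    rw [e₁, e₂, ← f₁, ← f₂, heq]
  -- Small `a ≤ b/2^t` are few for trivial reasons.
  have hF1 : ((F.filter fun q => q / d * 2 ^ t k ≤ b).card : ℝ) ≤ b / 2 ^ t k := by
    have h1 : (F.filter fun q => q / d * 2 ^ t k ≤ b).card ≤ (Finset.Icc 1 (b / 2 ^ t k)).card := by
      refine Finset.card_le_card_of_injOn (fun q => q / d) ?_ ?_
      · intro q hq
        obtain ⟨hqF, hq2⟩ := Finset.mem_filter.1 hq
        obtain ⟨a, e, f, h1, -⟩ := hFa q hqF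
        simp only [Finset.coe_Icc, Set.mem_Icc]
        exact ⟨f ▸ h1, (Nat.le_div_iff_mul_le (by positivity)).2 hq2⟩
      · intro q₁ h₁ q₂ h₂ heq
        exact hinj q₁ (Finset.mem_filter.1 h₁).1 q₂ (Finset.mem_filter.1 h₂).1 heq
    rw [Nat.card_Icc, Nat.add_sub_cancel] at h1
    calc _ ≤ ((b / 2 ^ t k : ℕ) : ℝ) := by exact_mod_cast h1
      _ ≤ (b : ℝ) / ((2 ^ t k : ℕ) : ℝ) := Nat.cast_div_le
      _ = _ := by push_cast; rfl
  -- For the remaining `a`, `q = da` lies at most `t` dyadic blocks below `q'`, so `near` compares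
  -- the scales of `q` and `q'`.
  have hlog : ∀ a, 1 ≤ a → a < b → b < a * 2 ^ t k → Nat.log 2 (d * a) ≤ k ∧
      k ≤ Nat.log 2 (d * a) + t k := by
    intro a ha hab hba
    constructor
    · rw [hk, hdb]; exact Nat.log_mono_right (Nat.mul_le_mul_left _ hab.le)
    · have h1 : 2 ^ k < 2 ^ (Nat.log 2 (d * a) + 1 + t k) := by
        calc 2 ^ k ≤ d * b := hdb ▸ hkq
          _ < d * (a * 2 ^ t k) := by gcongr
          _ = (d * a) * 2 ^ t k := by ring
          _ ≤ 2 ^ (Nat.log 2 (d * a) + 1) * 2 ^ t k := by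
              gcongr; exact (Nat.lt_pow_succ_log_self (by norm_num) _).le
          _ = _ := by rw [← pow_add]
      have := (Nat.pow_lt_pow_iff_right (by norm_num)).1 h1
      omega
  have hF2 : ((F.filter fun q => ¬ q / d * 2 ^ t k ≤ b).card : ℝ) ≤ 10 * b / 2 ^ t k := by
    have hF2a : ∀ q ∈ F.filter (fun q => ¬ q / d * 2 ^ t k ≤ b), ∃ a, q = d * a ∧ q / d = a ∧
        1 ≤ a ∧ a < b ∧ q ∈ s ∧ b < a * 2 ^ t k := by
      intro q hq
      obtain ⟨hqF, hq2⟩ := Finset.mem_filter.1 hq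
      obtain ⟨a, e, f, h1, h2, h3⟩ := hFa q hqF
      exact ⟨a, e, f, h1, h2, h3, by rw [f] at hq2; omega⟩
    have hinj2 : ∀ q₁ ∈ F.filter (fun q => ¬ q / d * 2 ^ t k ≤ b),
        ∀ q₂ ∈ F.filter (fun q => ¬ q / d * 2 ^ t k ≤ b), q₁ / d = q₂ / d → q₁ = q₂ :=
      fun q₁ h₁ q₂ h₂ heq =>
        hinj q₁ (Finset.mem_filter.1 h₁).1 q₂ (Finset.mem_filter.1 h₂).1 heq
    -- Small `d`: goodness of `q` puts `a(dβ)` within `2^(-t)` of `y`, and `β` is well distributed.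
    rcases le_or_gt d (2 ^ (10 * h k)) with hd2 | hd2
    · have h1 := (hβ k hg.le_log).card_norm_nsmul_sub_le y (b := b) hS.three_le hd hd2 hS.small
        (hdb ▸ hkq)
      have h2 : (F.filter fun q => ¬ q / d * 2 ^ t k ≤ b).card
          ≤ ((Finset.range b).filter fun a : ℕ => ‖a • (d • β) - y‖ ≤ (1 / 2 : ℝ) ^ t k).card := by
        refine Finset.card_le_card_of_injOn (fun q => q / d) ?_ hinj2
        intro q hq
        obtain ⟨a, rfl, f, h1, h2, h3, h4⟩ := hF2a q hq
        have h5 := hlog a h1 h2 h4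
        have h6 := (hr _ (hpos _ h3)).1.norm_le
        simp only [f, Finset.coe_filter, Finset.mem_range, Set.mem_ofPred_eq, smul_smul]
        refine ⟨h2, ?_⟩
        rw [mul_comm a d]
        exact h6.trans (pow_le_pow_of_le_one (by norm_num) (by norm_num) (hS.near _ h5.1 h5.2).1)
      calc _ ≤ 9 * (b : ℝ) / 2 ^ t k := le_trans (by exact_mod_cast h2) h1
        _ ≤ _ := by gcongr; norm_num
    -- Large `d`: the intersection gives `‖(b - a)γ‖ < a r(q') + b r(q)`, and both terms are at most
    -- `2^(6h+t)/d`, using `h l ≤ 3 h k` and `b < a 2^t`.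
    · set ξ : ℝ := 2 ^ (6 * h k + t k + 1) / 2 ^ (10 * h k) with hξ
      have hξ2 : 2 * ξ ≤ (1 / 2 : ℝ) ^ ((t k + 1) * w k + 1) := by
        rw [hξ, one_div_pow, ← mul_div_assoc, div_le_div_iff₀ (by positivity) (by positivity),
          one_mul, ← pow_succ', ← pow_add]
        exact pow_le_pow_right₀ (by norm_num) (by have := hS.far; omega)
      have h1 := (hγ k hg.le_log).card_norm_nsmul_lt_le (by have := hS.small; omega) hξ2 b
      have h2 : (F.filter fun q => ¬ q / d * 2 ^ t k ≤ b).card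
          ≤ ((Finset.Ico 1 b).filter fun c : ℕ => ‖c • γ‖ < ξ).card := by
        refine Finset.card_le_card_of_injOn (fun q => b - q / d) ?_ ?_
        · intro q hq
          obtain ⟨a, rfl, f, h1, h2, h3, h4⟩ := hF2a q hq
          have h5 := hlog a h1 h2 h4
          have h6 := (hr _ (hpos _ h3)).2
          obtain ⟨x, hx⟩ := hne _ h3
          have h7 := norm_sub_nsmul_lt_of_mem_inter (γ := γ) (x := x) (d := d) (a := a) (b := b)
            (r := r (d * a)) (r' := r q') h1 h2.le (by rw [← hdb]; exact hx)
          simp only [f, Finset.coe_filter, Finset.mem_Ico, Set.mem_ofPred_eq]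
          refine ⟨⟨by omega, by omega⟩, h7.trans_le ?_⟩
          have har : (0 : ℝ) < a := by exact_mod_cast h1
          have hra := (hpos _ h3).le
          have hab : (a : ℝ) ≤ b := by exact_mod_cast h2.le
          have hba : (b : ℝ) ≤ a * 2 ^ t k := by exact_mod_cast h4.le
          have hd2' : (2 : ℝ) ^ (10 * h k) ≤ d := by exact_mod_cast hd2.le
          have e1 : (a : ℝ) * r q' ≤ 2 ^ (6 * h k + t k) / 2 ^ (10 * h k) := by
            calc (a : ℝ) * r q' ≤ b * (2 ^ (2 * h k) / q') := by gcongr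
              _ = 2 ^ (2 * h k) / d := by rw [hdb]; push_cast; field_simp
              _ ≤ 2 ^ (6 * h k + t k) / 2 ^ (10 * h k) := by
                gcongr
                · norm_num
                · omega
          have e2 : (b : ℝ) * r (d * a) ≤ 2 ^ (6 * h k + t k) / 2 ^ (10 * h k) := by
            calc (b : ℝ) * r (d * a)
                ≤ (a * 2 ^ t k) * (2 ^ (2 * h (Nat.log 2 (d * a))) / ((d * a : ℕ) : ℝ)) := by gcongr
              _ = 2 ^ (2 * h (Nat.log 2 (d * a)) + t k) / d := by
                rw [pow_add]; push_cast; field_simp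
              _ ≤ 2 ^ (6 * h k + t k) / 2 ^ (10 * h k) := by
                have := (hS.near _ h5.1 h5.2).2
                exact div_le_div₀ (by positivity)
                  (pow_le_pow_right₀ (by norm_num) (by omega)) (by positivity) hd2'
          calc _ ≤ (2 : ℝ) ^ (6 * h k + t k) / 2 ^ (10 * h k)
                + 2 ^ (6 * h k + t k) / 2 ^ (10 * h k) := add_le_add e1 e2
            _ = ξ := by rw [hξ, pow_succ]; ring
        · intro q₁ h₁ q₂ h₂ heq
          obtain ⟨a₁, -, f₁, -, g₁, -⟩ := hF2a q₁ h₁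
          obtain ⟨a₂, -, f₂, -, g₂, -⟩ := hF2a q₂ h₂
          refine hinj2 q₁ h₁ q₂ h₂ ?_
          simp only [f₁, f₂] at heq ⊢
          omega
      have h3 : (2 : ℝ) ^ t k * ((Finset.Ico 1 b).filter fun c : ℕ => ‖c • γ‖ < ξ).card ≤ b := by
        exact_mod_cast h1
      have h4 : ((F.filter fun q => ¬ q / d * 2 ^ t k ≤ b).card : ℝ)
          ≤ ((Finset.Ico 1 b).filter fun c : ℕ => ‖c • γ‖ < ξ).card := by exact_mod_cast h2
      rw [le_div_iff₀ h2t]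
      nlinarith
  have hsplit := Finset.card_filter_add_card_filter_not (s := F) fun q => q / d * 2 ^ t k ≤ b
  have hsplit' : (F.card : ℝ) = ((F.filter fun q => q / d * 2 ^ t k ≤ b).card : ℝ)
      + ((F.filter fun q => ¬ q / d * 2 ^ t k ≤ b).card : ℝ) := by exact_mod_cast hsplit.symm
  rw [hsplit']
  calc _ ≤ (b : ℝ) / 2 ^ t k + 10 * b / 2 ^ t k := add_le_add hF1 hF2
    _ = _ := by ring

/-- On shell `j` one has `r(q) ≥ φ(q) 2^j`, which offsets the density `2^(-j)` of the shell, so all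
`h` shells contribute equally. -/
theorem le_sum_block_of_goodIndex {β y : UnitAddCircle} {t h w : ℕ → ℕ} {k₀ k : ℕ}
    (hk : k₀ ≤ k) (hS : ScaleConditions t h w k) (hβ : FarMultiples β (w k) k) {φ r : ℕ → ℝ}
    (hφ : ∀ q, 1 ≤ q → 0 ≤ φ q) (hφ' : AntitoneOn φ (Set.Ici 1)) (hr0 : ∀ q, 0 ≤ r q)
    (hr : ∀ q, GoodIndex β y t h k₀ q → r q = φ q / ‖q • β - y‖) :
    h k * 2 ^ k * φ (2 ^ (k + 1)) / 32 ≤ ∑ q ∈ Finset.Ico (2 ^ k) (2 ^ (k + 1)), r q := by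
  classical
  set I := Finset.Ico (2 ^ k) (2 ^ (k + 1))
  set Φ := φ (2 ^ (k + 1))
  have hΦ : 0 ≤ Φ := hφ _ Nat.one_le_two_pow
  let L : ℕ → Finset ℕ := fun j => I.filter fun q : ℕ =>
      (1 / 2 : ℝ) ^ (j + 1) < ‖q • β - y‖ ∧ ‖q • β - y‖ ≤ (1 / 2 : ℝ) ^ j
  let B := I.filter fun n : ℕ => 2 ^ t k < n.divisors.card
  have hh : 1 ≤ h k := by have := hS.far; omega
  -- The moment of order `8w` makes integers with many divisors at most half of every shell used,
  -- down to radius `2^(-2h)`.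
  have hB : (B.card : ℝ) ≤ 2 ^ k / 2 ^ (2 * h k + 5) := by
    have h1 := card_many_divisors_mul_le k (t k) (8 * w k)
    have h2 : ((k : ℝ) + 2) ^ 2 ^ (8 * w k) * 2 ^ (2 * h k + 6) ≤ (2 ^ t k) ^ (8 * w k) := by
      rw [← pow_mul]; exact_mod_cast hS.rare
    rw [le_div_iff₀ (by positivity)]
    have h3 : 0 < ((k : ℝ) + 2) ^ 2 ^ (8 * w k) := by positivity
    have h4 : (B.card : ℝ) * (((k : ℝ) + 2) ^ 2 ^ (8 * w k) * 2 ^ (2 * h k + 6))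
        ≤ 2 ^ (k + 1) * ((k : ℝ) + 2) ^ 2 ^ (8 * w k) :=
      (mul_le_mul_of_nonneg_left h2 (by positivity)).trans h1
    have h5 : (B.card : ℝ) * 2 ^ (2 * h k + 6) ≤ 2 ^ (k + 1) := by
      refine le_of_mul_le_mul_right ?_ h3
      linarith
    rw [pow_succ, pow_succ (2 : ℝ) k] at h5
    linarith
  have hlevel : ∀ j ∈ Finset.Ico (h k) (2 * h k),
      2 ^ k * Φ / 32 ≤ ∑ q ∈ L j \ B, r q := by
    intro j hj
    rw [Finset.mem_Ico] at hj
    have h1 : (2 : ℝ) ^ k / 2 ^ (j + 4) ≤ (L j).card :=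
      hβ.le_card_shell y (by omega) (by have := hS.small; nlinarith)
    have h2 : ((L j).card : ℝ) ≤ (L j \ B).card + B.card := by
      exact_mod_cast Finset.card_le_card_sdiff_add_card
    have h3 : (B.card : ℝ) ≤ 2 ^ k / 2 ^ (j + 5) := by
      refine hB.trans ?_
      gcongr
      · norm_num
      · omega
    have h4 : (2 : ℝ) ^ k / 2 ^ (j + 5) ≤ (L j \ B).card := by
      have : (2 : ℝ) ^ k / 2 ^ (j + 4) = 2 * (2 ^ k / 2 ^ (j + 5)) := by
        rw [pow_succ (2 : ℝ) (j + 4)]; field_simp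
      linarith
    calc 2 ^ k * Φ / 32 = 2 ^ k / 2 ^ (j + 5) * (Φ * 2 ^ j) := by
          rw [pow_add]; field_simp; norm_num
      _ ≤ (L j \ B).card * (Φ * 2 ^ j) := by gcongr
      _ = ∑ q ∈ L j \ B, Φ * 2 ^ j := by rw [Finset.sum_const, nsmul_eq_mul]
      _ ≤ _ := by
          refine Finset.sum_le_sum fun q hq => ?_
          obtain ⟨hqL, hqB⟩ := Finset.mem_sdiff.1 hq
          obtain ⟨hqI, hq1, hq2⟩ := Finset.mem_filter.1 hqL
          have hqI' := Finset.mem_Ico.1 hqI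
          have hq0 : 1 ≤ q := Nat.one_le_two_pow.trans hqI'.1
          have hlog : Nat.log 2 q = k := Nat.log_eq_of_pow_le_of_lt_pow hqI'.1 hqI'.2
          have hgood : GoodIndex β y t h k₀ q := by
            refine ⟨hq0, by rwa [hlog], ?_, ?_, ?_⟩
            · rw [hlog]
              by_contra! hc
              exact hqB (Finset.mem_filter.2 ⟨hqI, hc⟩)
            · rw [hlog]
              exact (pow_le_pow_of_le_one (by norm_num) (by norm_num) (by omega)).trans hq1.le
            · rw [hlog]
              exact hq2.trans (pow_le_pow_of_le_one (by norm_num) (by norm_num) hj.1)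
          rw [hr q hgood]
          have hpos : 0 < ‖q • β - y‖ := lt_trans (by positivity) hq1
          rw [le_div_iff₀ hpos]
          calc Φ * 2 ^ j * ‖q • β - y‖ ≤ Φ * 2 ^ j * (1 / 2 : ℝ) ^ j := by gcongr
            _ = Φ * (2 ^ j * (1 / 2 : ℝ) ^ j) := by ring
            _ = Φ := by rw [← mul_pow]; norm_num
            _ ≤ φ q := hφ' (Set.mem_Ici.2 hq0) (Set.mem_Ici.2 Nat.one_le_two_pow) hqI'.2.le
  have hdisj : ((Finset.Ico (h k) (2 * h k) : Finset ℕ) : Set ℕ).PairwiseDisjoint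
      fun j => L j \ B := by
    have hlt : ∀ i j : ℕ, i < j → Disjoint (L i \ B) (L j \ B) := by
      intro i j hij
      rw [Finset.disjoint_left]
      intro q hq hq'
      have h1 := (Finset.mem_filter.1 (Finset.mem_sdiff.1 hq).1).2.1
      have h2 := (Finset.mem_filter.1 (Finset.mem_sdiff.1 hq').1).2.2
      have h3 : (1 / 2 : ℝ) ^ j ≤ (1 / 2 : ℝ) ^ (i + 1) :=
        pow_le_pow_of_le_one (by norm_num) (by norm_num) hij
      linarith
    intro i _ j _ hij
    rcases lt_or_gt_of_ne hij with h' | h'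
    · exact hlt i j h'
    · exact (hlt j i h').symm
  calc h k * 2 ^ k * Φ / 32 = ∑ j ∈ Finset.Ico (h k) (2 * h k), 2 ^ k * Φ / 32 := by
        rw [Finset.sum_const, Nat.card_Ico, nsmul_eq_mul, show 2 * h k - h k = h k by omega]
        ring
    _ ≤ ∑ j ∈ Finset.Ico (h k) (2 * h k), ∑ q ∈ L j \ B, r q := Finset.sum_le_sum hlevel
    _ = ∑ q ∈ (Finset.Ico (h k) (2 * h k)).biUnion fun j => L j \ B, r q :=
        (Finset.sum_biUnion hdisj).symm
    _ ≤ _ := by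
        refine Finset.sum_le_sum_of_subset_of_nonneg ?_ fun q _ _ => hr0 q
        intro q hq
        obtain ⟨j, -, hq⟩ := Finset.mem_biUnion.1 hq
        exact (Finset.mem_filter.1 (Finset.mem_sdiff.1 hq).1).1

/-! ### Choice of the scales -/

/-- The exponent `A * ⌊√⌊log₂ k⌋⌋` bounding the Diophantine exponents up to height `2 ^ (k + 2)`. -/
def diophScale (A k : ℕ) : ℕ := A * Nat.sqrt (Nat.log 2 k)

/-- The order `k/√(log k)` is that of the weight `log q / √(log log q)`; the factor `32` leaves room
for the product of `10h` and the exponent `w` in `small`. -/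
def shellScale (A k : ℕ) : ℕ := k / (32 * diophScale A k)

/-- With moments of order `8w`, `8wt ≈ k/(8w)` must exceed `2h ≈ k/(16w)` (`rare`), while `tw ≈ h/2`
is still absorbed by `4h` (`far`). -/
def divisorScale (A k : ℕ) : ℕ := k / (64 * diophScale A k ^ 2)

/-- The left side is at most `2` to a linear function of `m`, which `m^2 ≤ log₂ k` dominates. In
particular `2^(8w)`, the exponent in the divisor moments, is negligible against `h`. -/
theorem two_pow_mul_sqrt_log_le {A m k : ℕ} (hm : 9 * A + 12 ≤ m)
    (hmk : m = Nat.sqrt (Nat.log 2 k)) (hk : k ≠ 0) :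
    ((m + 1) ^ 2 + 2) * 2 ^ (8 * (A * m)) * (32 * (A * m)) ≤ k := by
  have h1 : m ^ 2 ≤ Nat.log 2 k := hmk ▸ Nat.sqrt_le' _
  have h2 : m + 1 ≤ 2 ^ m := Nat.lt_two_pow_self
  have h3 : A ≤ 2 ^ A := Nat.lt_two_pow_self.le
  have h4 : (m + 1) ^ 2 + 2 ≤ 2 ^ (2 * m + 2) := by
    calc (m + 1) ^ 2 + 2 ≤ (2 ^ m) ^ 2 + 2 * (2 ^ m) ^ 2 := by
          have : 1 ≤ (2 ^ m) ^ 2 := Nat.one_le_pow _ _ (by positivity)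
          have : (m + 1) ^ 2 ≤ (2 ^ m) ^ 2 := Nat.pow_le_pow_left h2 2
          omega
      _ ≤ 2 ^ (2 * m + 2) := by
          rw [pow_add, mul_comm 2 m, pow_mul]; omega
  calc ((m + 1) ^ 2 + 2) * 2 ^ (8 * (A * m)) * (32 * (A * m))
      ≤ 2 ^ (2 * m + 2) * 2 ^ (8 * (A * m)) * (2 ^ 5 * (2 ^ A * 2 ^ m)) := by
        gcongr <;> omega
    _ = 2 ^ (2 * m + 2 + 8 * (A * m) + (5 + (A + m))) := by
        rw [← pow_add, ← pow_add, ← pow_add, ← pow_add]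
    _ ≤ 2 ^ m ^ 2 := Nat.pow_le_pow_right (by norm_num) (by nlinarith)
    _ ≤ 2 ^ Nat.log 2 k := Nat.pow_le_pow_right (by norm_num) h1
    _ ≤ k := Nat.pow_log_le_self 2 hk

theorem scaleConditions_of_le {A k : ℕ} (hA : 1 ≤ A)
    (hm : 9 * A + 12 ≤ Nat.sqrt (Nat.log 2 k)) (hk : k ≠ 0) :
    ScaleConditions (divisorScale A) (shellScale A) (diophScale A) k := by
  set m := Nat.sqrt (Nat.log 2 k) with hmdef
  have hbig := two_pow_mul_sqrt_log_le hm hmdef hk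
  set w := A * m with hw
  have hwk : diophScale A k = w := rfl
  have hw1 : 1 ≤ w := Nat.mul_pos hA (by omega)
  set h := shellScale A k with hh
  set t := divisorScale A k with ht
  have hh' : h = k / (32 * w) := rfl
  have ht' : t = k / (64 * w ^ 2) := rfl
  have h1 : h * (32 * w) ≤ k := Nat.div_mul_le_self _ _
  have h2 : k < (h + 1) * (32 * w) := Nat.lt_mul_of_div_lt (Nat.lt_succ_self _) (by positivity)
  have h3 : t * (64 * w ^ 2) ≤ k := Nat.div_mul_le_self _ _
  have h4 : k < (t + 1) * (64 * w ^ 2) :=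
    Nat.lt_mul_of_div_lt (Nat.lt_succ_self _) (by positivity)
  have hhbig : ((m + 1) ^ 2 + 2) * 2 ^ (8 * w) ≤ h :=
    (Nat.le_div_iff_mul_le (by positivity)).2 hbig
  have h5 : 2 * w * t ≤ h := by
    have : (2 * w * t) * (32 * w) < (h + 1) * (32 * w) := by nlinarith
    have := lt_of_mul_lt_mul_right this (Nat.zero_le _)
    omega
  have h6 : h < 2 * w * (t + 1) := by
    have : h * (32 * w) < (2 * w * (t + 1)) * (32 * w) := by nlinarith
    exact lt_of_mul_lt_mul_right this (Nat.zero_le _)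
  have h7 : 8 * w + 6 ≤ h := by
    have e1 : 8 * w + 1 ≤ 2 ^ (8 * w) := Nat.lt_two_pow_self
    have e2 : 6 ≤ (m + 1) ^ 2 + 2 := by nlinarith
    calc 8 * w + 6 ≤ 6 * (8 * w + 1) := by omega
      _ ≤ ((m + 1) ^ 2 + 2) * 2 ^ (8 * w) := Nat.mul_le_mul e2 e1
      _ ≤ h := hhbig
  have hth : t ≤ h := by nlinarith
  refine ⟨?_, ?_, ?_, ?_, ?_, ?_⟩
  · by_contra! hc
    have : 2 * w * (t + 1) ≤ 2 * w * 3 := by gcongr; omega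
    omega
  · intro l hl hlt
    rw [← hh, ← ht] at *
    have e1 : 64 * t ≤ k := by
      calc 64 * t = t * (64 * 1) := by ring
        _ ≤ t * (64 * w ^ 2) := by gcongr; exact Nat.one_le_pow _ _ hw1
        _ ≤ k := h3
    have e2 : k ≤ 2 * l := by omega
    have hl0 : l ≠ 0 := by omega
    -- As `k ≤ 2l`, the logarithm drops by at most one from `k` to `l`, hence so does its root.
    have e3 : Nat.log 2 k ≤ Nat.log 2 l + 1 := by
      calc Nat.log 2 k ≤ Nat.log 2 (l * 2) := Nat.log_mono_right (by omega)
        _ = Nat.log 2 l + 1 := Nat.log_mul_base (by norm_num) hl0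
    set n := Nat.sqrt (Nat.log 2 l) with hn
    have e4 : n ≤ m := Nat.sqrt_le_sqrt (Nat.log_mono_right hl)
    have e5 : m ≤ n + 1 := by
      calc m ≤ Nat.sqrt (Nat.log 2 l + 1) := Nat.sqrt_le_sqrt e3
        _ ≤ n + 1 := Nat.sqrt_succ_le_succ_sqrt _
    have e6 : 1 ≤ n := by omega
    have e7 : shellScale A l = l / (32 * (A * n)) := rfl
    have hAn : 0 < A * n := Nat.mul_pos hA e6
    constructor
    · rw [e7, Nat.le_div_iff_mul_le (by positivity)]
      calc t * (32 * (A * n)) ≤ t * (32 * (A * m)) := by gcongr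
        _ = t * (32 * w * 1) := by ring
        _ ≤ t * (32 * w * w) := by gcongr
        _ ≤ l := by nlinarith
    · have e8 : w ≤ 2 * (A * n) := by
        calc w ≤ A * (2 * n) := by rw [hw]; gcongr; omega
          _ = _ := by ring
      have e9 : shellScale A l * (32 * (A * n)) ≤ l := Nat.div_mul_le_self _ _
      have e10 : shellScale A l * (32 * (A * n)) < (2 * (h + 1)) * (32 * (A * n)) := by
        calc _ ≤ k := e9.trans hl
          _ < (h + 1) * (32 * w) := h2
          _ ≤ (h + 1) * (32 * (2 * (A * n))) := by gcongr
          _ = _ := by ring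
      have e11 := lt_of_mul_lt_mul_right e10 (Nat.zero_le _)
      omega
  · rw [← hh, ← ht, hwk]
    nlinarith
  · rw [← hh, ← ht, hwk]
    nlinarith
  · rw [← hh, ← ht, hwk]
    have e1 : k + 2 ≤ 2 ^ ((m + 1) ^ 2 + 2) := by
      have e2 : Nat.log 2 k < (m + 1) ^ 2 := Nat.lt_succ_sqrt' _
      have e3 : k < 2 ^ (Nat.log 2 k + 1) := Nat.lt_pow_succ_log_self (by norm_num) k
      have e4 : 2 ^ (Nat.log 2 k + 1) ≤ 2 ^ (m + 1) ^ 2 := Nat.pow_le_pow_right (by norm_num) e2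
      have e5 : 1 ≤ 2 ^ (m + 1) ^ 2 := Nat.one_le_two_pow
      rw [pow_add]; omega
    calc (k + 2) ^ 2 ^ (8 * w) * 2 ^ (2 * h + 6)
        ≤ (2 ^ ((m + 1) ^ 2 + 2)) ^ 2 ^ (8 * w) * 2 ^ (2 * h + 6) := by gcongr
      _ = 2 ^ (((m + 1) ^ 2 + 2) * 2 ^ (8 * w) + (2 * h + 6)) := by rw [← pow_mul, ← pow_add]
      _ ≤ 2 ^ (t * (8 * w)) := Nat.pow_le_pow_right (by norm_num) (by nlinarith)
  · rw [← hh, hwk]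
    calc k ≤ (h + 1) * (32 * w) := h2.le
      _ ≤ (2 * h) * (32 * w) := by gcongr; omega
      _ = 64 * w * h := by ring

theorem exists_forall_le_sqrt_log (M : ℕ) : ∃ k₀, ∀ k ≥ k₀, M ≤ Nat.sqrt (Nat.log 2 k) := by
  refine ⟨2 ^ M ^ 2, fun k hk => ?_⟩
  rw [Nat.le_sqrt', Nat.le_log_iff_pow_le (by norm_num)]
  · exact hk
  · have : 0 < 2 ^ M ^ 2 := by positivity
    omega

/-! ### From Diophantine exponents to `FarMultiples` -/

theorem norm_eq_distInt (x : ℝ) : ‖(x : UnitAddCircle)‖ = distInt x := UnitAddCircle.norm_eq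

/-- Exponents say nothing about height `1`, so the hypothesis is used at `2n` and `‖nx‖ ≥ ‖2nx‖/2`.
This explains both shifts in `(e + 1) * w + 1`. -/
theorem farMultiples_of_forall_le {x s : ℝ} {w k : ℕ} (hsw : s ≤ w)
    (H : ∀ n : ℕ, 1 ≤ n → n ≤ 2 ^ k → ((2 * n : ℕ) : ℝ) ^ (-s) ≤ distInt ((2 * n : ℕ) * x)) :
    FarMultiples (x : UnitAddCircle) w k := by
  intro e he n hn hne
  have h1 := H n hn (hne.trans (Nat.pow_le_pow_right (by norm_num) he))
  rw [← norm_eq_distInt, coe_nat_mul, mul_smul] at h1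
  have h2 : ‖2 • n • (x : UnitAddCircle)‖ ≤ 2 * ‖n • (x : UnitAddCircle)‖ := by
    simpa using norm_nsmul_le (n := 2) (a := n • (x : UnitAddCircle))
  have h3 : (1 / 2 : ℝ) ^ ((e + 1) * w) ≤ ((2 * n : ℕ) : ℝ) ^ (-s) := by
    have e1 : (1 : ℝ) ≤ ((2 * n : ℕ) : ℝ) := by exact_mod_cast (by omega : 1 ≤ 2 * n)
    have e2 : ((2 * n : ℕ) : ℝ) ≤ 2 ^ (e + 1) := by
      rw [pow_succ']; exact_mod_cast Nat.mul_le_mul_left 2 hne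
    rw [Real.rpow_neg (by positivity), one_div, inv_pow]
    refine inv_anti₀ (Real.rpow_pos_of_pos (by linarith) _) ?_
    calc ((2 * n : ℕ) : ℝ) ^ s ≤ ((2 * n : ℕ) : ℝ) ^ (w : ℝ) :=
          Real.rpow_le_rpow_of_exponent_le e1 hsw
      _ = ((2 * n : ℕ) : ℝ) ^ w := Real.rpow_natCast _ _
      _ ≤ (2 ^ (e + 1)) ^ w := by gcongr
      _ = _ := by rw [← pow_mul]
  rw [pow_succ]
  linarith

theorem sqrt_logb_logb_two_pow_le {k : ℕ} (hk : 2 ≤ k) :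
    Real.sqrt (Real.logb 2 (Real.logb 2 ((2 ^ (k + 2) : ℕ) : ℝ)))
      ≤ 3 * Nat.sqrt (Nat.log 2 k) := by
  have h1 : Real.logb 2 ((2 ^ (k + 2) : ℕ) : ℝ) = ((k + 2 : ℕ) : ℝ) := by
    push_cast
    rw [Real.logb_pow, Real.logb_self_eq_one (by norm_num)]; push_cast; ring
  set m := Nat.sqrt (Nat.log 2 k)
  have h2 : Nat.log 2 k < (m + 1) ^ 2 := Nat.lt_succ_sqrt' _
  have hm : 1 ≤ m := by
    rw [Nat.le_sqrt', Nat.le_log_iff_pow_le (by norm_num) (by omega)]; simpa using hk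
  have h3 : k + 2 ≤ 2 ^ ((m + 1) ^ 2 + 1) := by
    calc k + 2 ≤ 2 ^ (Nat.log 2 k + 1) * 2 := by
          have := Nat.lt_pow_succ_log_self (b := 2) (by norm_num) k; omega
      _ = 2 ^ (Nat.log 2 k + 1 + 1) := by rw [← pow_succ]
      _ ≤ _ := Nat.pow_le_pow_right (by norm_num) (by omega)
  have h4 : Real.logb 2 ((k + 2 : ℕ) : ℝ) ≤ (m + 1) ^ 2 + 1 := by
    rw [Real.logb_le_iff_le_rpow (by norm_num) (by positivity)]
    calc ((k + 2 : ℕ) : ℝ) ≤ ((2 ^ ((m + 1) ^ 2 + 1) : ℕ) : ℝ) := by exact_mod_cast h3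
      _ = _ := by
        rw [show ((m : ℝ) + 1) ^ 2 + 1 = (((m + 1) ^ 2 + 1 : ℕ) : ℝ) by push_cast; ring,
          Real.rpow_natCast]
        push_cast; rfl
  rw [h1]
  refine Real.sqrt_le_iff.2 ⟨by positivity, h4.trans ?_⟩
  have hm' : (1 : ℝ) ≤ m := by exact_mod_cast hm
  nlinarith

theorem exists_farMultiples {γ β : ℝ} (hσ : ∃ C : ℝ, ∀ q : ℕ, 3 ≤ q →
      sigmaPair γ β q ≤ ENNReal.ofReal (C * Real.sqrt (Real.logb 2 (Real.logb 2 q)))) :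
    ∃ A : ℕ, 1 ≤ A ∧ ∀ k ≥ 2, FarMultiples (γ : UnitAddCircle) (diophScale A k) k ∧
      FarMultiples (β : UnitAddCircle) (diophScale A k) k := by
  obtain ⟨C, hC⟩ := hσ
  refine ⟨⌈3 * |C| + 1⌉₊, Nat.one_le_ceil_iff.2 (by positivity), fun k hk => ?_⟩
  set m := Nat.sqrt (Nat.log 2 k) with hm
  have hm1 : 1 ≤ m := by
    rw [Nat.le_sqrt', Nat.le_log_iff_pow_le (by norm_num) (by omega)]; simpa using hk
  have h1 := hC (2 ^ (k + 2)) (by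
    calc 3 ≤ 2 ^ 2 := by norm_num
      _ ≤ 2 ^ (k + 2) := Nat.pow_le_pow_right (by norm_num) (by omega))
  have hs := sqrt_logb_logb_two_pow_le hk
  set u := Real.sqrt (Real.logb 2 (Real.logb 2 ((2 ^ (k + 2) : ℕ) : ℝ)))
  have hu : 0 ≤ u := Real.sqrt_nonneg _
  -- The added `1` gives strict inequality, so some admissible exponent lies below the bound; it is
  -- absorbed into `A` because `m ≥ 1`.
  have h2 : sigmaPair γ β (2 ^ (k + 2)) < ENNReal.ofReal (|C| * u + 1) := by
    refine h1.trans_lt ?_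
    rw [ENNReal.ofReal_lt_ofReal_iff (by positivity)]
    have := mul_le_mul_of_nonneg_right (le_abs_self C) hu
    linarith
  obtain ⟨_, ⟨s, ⟨hs0, hsd⟩, rfl⟩, hslt⟩ := sInf_lt_iff.1 h2
  rw [ENNReal.ofReal_lt_ofReal_iff (by positivity)] at hslt
  have hsw : s ≤ (diophScale ⌈3 * |C| + 1⌉₊ k : ℕ) := by
    have e1 : (1 : ℝ) ≤ m := by exact_mod_cast hm1
    have e2 : 3 * |C| + 1 ≤ (⌈3 * |C| + 1⌉₊ : ℝ) := Nat.le_ceil _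
    calc s ≤ |C| * u + 1 := hslt.le
      _ ≤ |C| * (3 * m) + m := by gcongr
      _ = (3 * |C| + 1) * m := by ring
      _ ≤ ⌈3 * |C| + 1⌉₊ * m := by gcongr
      _ = _ := by rw [diophScale]; push_cast; rfl
  have hmax : ∀ n : ℕ, 1 ≤ n → n ≤ 2 ^ k →
      (2 : ℤ) ≤ ((2 * n : ℕ) : ℤ) ∧ ((2 * n : ℕ) : ℤ) ≤ ((2 ^ (k + 2) : ℕ) : ℤ) := by
    intro n hn hnk
    refine ⟨by exact_mod_cast (by omega : 2 ≤ 2 * n), ?_⟩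
    have : 2 ^ (k + 2) = 4 * 2 ^ k := by ring
    exact_mod_cast (by omega : 2 * n ≤ 2 ^ (k + 2))
  constructor
  · refine farMultiples_of_forall_le hsw fun n hn hnk => ?_
    have e := hmax n hn hnk
    have e0 : max |((2 * n : ℕ) : ℤ)| |(0 : ℤ)| = ((2 * n : ℕ) : ℤ) := by
      rw [Nat.abs_cast, abs_zero]; exact max_eq_left (by positivity)
    have h := hsd ((2 * n : ℕ) : ℤ) 0 (e0.symm ▸ e.1) (e0.symm ▸ e.2)
    rw [e0] at h
    simpa using h
  · refine farMultiples_of_forall_le hsw fun n hn hnk => ?_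
    have e := hmax n hn hnk
    have e0 : max |(0 : ℤ)| |((2 * n : ℕ) : ℤ)| = ((2 * n : ℕ) : ℤ) := by
      rw [Nat.abs_cast, abs_zero]; exact max_eq_right (by positivity)
    have h := hsd 0 ((2 * n : ℕ) : ℤ) (e0.symm ▸ e.1) (e0.symm ▸ e.2)
    rw [e0] at h
    simpa using h

/-! ### Cauchy condensation -/

theorem sum_Ico_two_pow_le {φ f : ℕ → ℝ} {k₀ : ℕ}
    (H : ∀ k ≥ k₀, ∑ q ∈ Finset.Ico (2 ^ k) (2 ^ (k + 1)), φ q ≤ f k) (n : ℕ) :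
    ∑ q ∈ Finset.Ico (2 ^ k₀) (2 ^ (k₀ + n)), φ q ≤ ∑ i ∈ Finset.range n, f (k₀ + i) := by
  induction n with
  | zero => simp
  | succ n ih =>
    rw [Finset.sum_range_succ, ← Finset.sum_Ico_consecutive φ
      (Nat.pow_le_pow_right (by norm_num) (Nat.le_add_right k₀ n) : 2 ^ k₀ ≤ 2 ^ (k₀ + n))
      (Nat.pow_le_pow_right (by norm_num) (by omega))]
    exact add_le_add ih (H (k₀ + n) (by omega))

theorem le_sum_Ico_two_pow {φ f : ℕ → ℝ} {k₀ : ℕ}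
    (H : ∀ k ≥ k₀, f k ≤ ∑ q ∈ Finset.Ico (2 ^ k) (2 ^ (k + 1)), φ q) (n : ℕ) :
    ∑ i ∈ Finset.range n, f (k₀ + i) ≤ ∑ q ∈ Finset.Ico (2 ^ k₀) (2 ^ (k₀ + n)), φ q := by
  have h := sum_Ico_two_pow_le (φ := fun q => -φ q) (f := fun k => -f k) (k₀ := k₀)
    (fun k hk => by rw [Finset.sum_neg_distrib]; exact neg_le_neg (H k hk)) n
  rw [Finset.sum_neg_distrib, Finset.sum_neg_distrib] at h
  exact neg_le_neg_iff.1 h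

/-- The weight `log q / (log log q) ^ (1 / 2)`. -/
noncomputable def logWeight (q : ℕ) : ℝ :=
  Real.logb 2 q / Real.sqrt (Real.logb 2 (Real.logb 2 q))

theorem logWeight_nonneg {q : ℕ} (hq : 1 ≤ q) : 0 ≤ logWeight q :=
  div_nonneg (Real.logb_nonneg (by norm_num) (by exact_mod_cast hq)) (Real.sqrt_nonneg _)

theorem logWeight_le {A k q : ℕ} (hk : 2 ≤ k)
    (hS : k ≤ 64 * diophScale A k * shellScale A k)
    (hq : 2 ^ (k + 1) ≤ q) (hq' : q < 2 ^ (k + 2)) :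
    logWeight q ≤ 128 * A * shellScale A k := by
  set h := shellScale A k
  set m := Nat.sqrt (Nat.log 2 k) with hm
  have hlog : ((k : ℝ) + 1) ≤ Real.logb 2 q := by
    rw [Real.le_logb_iff_rpow_le (by norm_num)
      (by exact_mod_cast lt_of_lt_of_le (by positivity) hq)]
    rw [show (k : ℝ) + 1 = ((k + 1 : ℕ) : ℝ) by push_cast; rfl, Real.rpow_natCast]
    exact_mod_cast hq
  have hlog' : Real.logb 2 q ≤ (k : ℝ) + 2 := by
    rw [Real.logb_le_iff_le_rpow (by norm_num)
      (by exact_mod_cast lt_of_lt_of_le (by positivity) hq)]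
    rw [show (k : ℝ) + 2 = ((k + 2 : ℕ) : ℝ) by push_cast; rfl, Real.rpow_natCast]
    exact_mod_cast hq'.le
  have hk0 : (2 : ℝ) ≤ k := by exact_mod_cast hk
  have hmlog : (m : ℝ) ≤ Real.sqrt (Real.logb 2 (Real.logb 2 q)) := by
    refine Real.le_sqrt_of_sq_le ?_
    calc (m : ℝ) ^ 2 ≤ (Nat.log 2 k : ℝ) := by exact_mod_cast Nat.sqrt_le' (Nat.log 2 k)
      _ ≤ Real.logb 2 k := Real.natLog_le_logb k 2
      _ ≤ Real.logb 2 (Real.logb 2 q) :=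
        Real.logb_le_logb_of_le (by norm_num) (by linarith) (by linarith)
  have hm1 : 1 ≤ m := by
    rw [Nat.le_sqrt', Nat.le_log_iff_pow_le (by norm_num) (by omega)]; simpa using hk
  have hm1' : (1 : ℝ) ≤ m := by exact_mod_cast hm1
  have hS' : (k : ℝ) ≤ 64 * (A * m) * h := by exact_mod_cast hS
  rw [logWeight, div_le_iff₀ (by linarith)]
  calc Real.logb 2 q ≤ 2 * k := by linarith
    _ ≤ 128 * A * h * m := by linarith
    _ ≤ _ := by gcongr

/-- By monotonicity the block starting at `2^(l+1)` is controlled by `ψ(2^(l+1))`, the value in the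
condensed term of index `l`. -/
theorem not_summable_condensed {ψ : ℕ → ℝ} (hψ0 : ∀ q : ℕ, 1 ≤ q → 0 ≤ ψ q)
    (hψ : AntitoneOn ψ (Set.Ici 1))
    (hdiv : Filter.Tendsto (fun Q : ℕ => ∑ q ∈ Finset.Icc 3 Q, ψ q * logWeight q)
      Filter.atTop Filter.atTop) {A k₀ : ℕ} (hk₀ : 2 ≤ k₀)
    (hS : ∀ k ≥ k₀, k ≤ 64 * diophScale A k * shellScale A k) :
    ¬ Summable fun k : ℕ => shellScale A k * 2 ^ k * ψ (2 ^ (k + 1)) := by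
  intro hsum
  set f : ℕ → ℝ := fun k => shellScale A k * 2 ^ k * ψ (2 ^ (k + 1)) with hf
  have hf0 : ∀ k, 0 ≤ f k := fun k => by
    have := hψ0 (2 ^ (k + 1)) Nat.one_le_two_pow
    positivity
  have hblock : ∀ k ≥ k₀ + 1, ∑ q ∈ Finset.Ico (2 ^ k) (2 ^ (k + 1)), ψ q * logWeight q
      ≤ 256 * A * f (k - 1) := by
    intro k hk
    obtain ⟨l, rfl⟩ := Nat.exists_eq_add_of_le' (show 1 ≤ k by omega)
    rw [Nat.add_sub_cancel]
    calc _ ≤ ∑ q ∈ Finset.Ico (2 ^ (l + 1)) (2 ^ (l + 1 + 1)),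
          ψ (2 ^ (l + 1)) * (128 * A * shellScale A l) := by
          refine Finset.sum_le_sum fun q hq => ?_
          rw [Finset.mem_Ico] at hq
          have hq1 : 1 ≤ q := Nat.one_le_two_pow.trans hq.1
          exact mul_le_mul (hψ (Set.mem_Ici.2 Nat.one_le_two_pow) (Set.mem_Ici.2 hq1) hq.1)
            (logWeight_le (by omega) (hS l (by omega)) hq.1 hq.2) (logWeight_nonneg hq1)
            (hψ0 _ Nat.one_le_two_pow)
      _ = 256 * A * f l := by
          rw [Finset.sum_const, Nat.card_Ico, nsmul_eq_mul,
            show 2 ^ (l + 1 + 1) - 2 ^ (l + 1) = 2 * 2 ^ l by rw [pow_succ, pow_succ]; omega]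
          simp only [hf]; push_cast; ring
  set c := ∑ q ∈ Finset.Ico 3 (2 ^ (k₀ + 1)), ψ q * logWeight q
  have hbound : ∀ Q : ℕ, ∑ q ∈ Finset.Icc 3 Q, ψ q * logWeight q ≤ c + 256 * A * ∑' k, f k := by
    intro Q
    have h3 : 3 ≤ 2 ^ (k₀ + 1) :=
      calc 3 ≤ 2 ^ 2 := by norm_num
        _ ≤ 2 ^ (k₀ + 1) := Nat.pow_le_pow_right (by norm_num) (by omega)
    calc _ ≤ ∑ q ∈ Finset.Ico 3 (2 ^ (k₀ + 1 + Q)), ψ q * logWeight q := by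
          refine Finset.sum_le_sum_of_subset_of_nonneg ?_ ?_
          · intro q hq
            rw [Finset.mem_Icc] at hq
            have h1 : Q < 2 ^ Q := Nat.lt_two_pow_self
            have h2 : 2 ^ Q ≤ 2 ^ (k₀ + 1 + Q) := Nat.pow_le_pow_right (by norm_num) (by omega)
            exact Finset.mem_Ico.2 ⟨hq.1, by omega⟩
          · intro q hq _
            have hq1 : 1 ≤ q := by have := (Finset.mem_Ico.1 hq).1; omega
            exact mul_nonneg (hψ0 q hq1) (logWeight_nonneg hq1)
      _ = c + ∑ q ∈ Finset.Ico (2 ^ (k₀ + 1)) (2 ^ (k₀ + 1 + Q)), ψ q * logWeight q :=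
          (Finset.sum_Ico_consecutive _ h3 (Nat.pow_le_pow_right (by norm_num) (by omega))).symm
      _ ≤ c + ∑ i ∈ Finset.range Q, 256 * A * f (k₀ + 1 + i - 1) := by
          gcongr
          exact sum_Ico_two_pow_le (f := fun k => 256 * A * f (k - 1)) hblock Q
      _ = c + 256 * A * ∑ i ∈ Finset.range Q, f (k₀ + i) := by
          rw [Finset.mul_sum]
          congr 1
          refine Finset.sum_congr rfl fun i _ => ?_
          rw [show k₀ + 1 + i - 1 = k₀ + i by omega]
      _ ≤ _ := by
          gcongr
          calc ∑ i ∈ Finset.range Q, f (k₀ + i)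
              = ∑ k ∈ (Finset.range Q).map (addLeftEmbedding k₀), f k := by
                rw [Finset.sum_map]; rfl
            _ ≤ ∑' k, f k := hsum.sum_le_tsum _ fun k _ => hf0 k
  obtain ⟨Q, hQ⟩ := (hdiv.eventually_gt_atTop (c + 256 * A * ∑' k, f k)).exists
  exact absurd (hbound Q) (not_le.2 hQ)

/-- Where `1/q` is the smaller, the truncated term is `h/2 ≥ 1`. If the truncated series converged
this could happen only finitely often, so truncation would not matter. -/
theorem not_summable_condensed_min {ψ : ℕ → ℝ} {A k₀ : ℕ}
    (h : ∀ k ≥ k₀, 2 ≤ shellScale A k)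
    (hns : ¬ Summable fun k : ℕ => shellScale A k * 2 ^ k * ψ (2 ^ (k + 1))) :
    ¬ Summable fun k : ℕ => shellScale A k * 2 ^ k *
      min (ψ (2 ^ (k + 1))) (1 / ((2 ^ (k + 1) : ℕ) : ℝ)) := by
  intro hs
  refine hns (hs.congr_atTop ?_)
  filter_upwards [hs.tendsto_atTop_zero.eventually_lt_const one_pos,
    Filter.eventually_ge_atTop k₀] with k hk hkk
  congr 1
  refine min_eq_left ?_
  by_contra! hc
  rw [min_eq_right hc.le] at hk
  have h2 : (2 : ℝ) ≤ shellScale A k := by exact_mod_cast h k hkk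
  have h3 : (shellScale A k : ℝ) * 2 ^ k * (1 / ((2 ^ (k + 1) : ℕ) : ℝ)) = shellScale A k / 2 := by
    push_cast; rw [pow_succ]; field_simp
  linarith

theorem ScaleConditions.le_shell {t h w : ℕ → ℕ} {k : ℕ} (hS : ScaleConditions t h w k) :
    w k ≤ h k := by
  have h1 := hS.far
  have h2 : 4 * w k ≤ (t k + 1) * w k := Nat.mul_le_mul_right _ (by have := hS.three_le; omega)
  omega

/-! ### The two monotone cases -/

theorem volume_W_eq_one_of_ae {ψ : ℕ → ℝ} {β γ γ' : ℝ} {P : UnitAddCircle → Prop}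
    (hP : ∀ᵐ x, P x)
    (h : ∀ x : ℝ, P x → {q : ℕ | 1 ≤ q ∧ distInt (q * x - γ) * distInt (q * β - γ') < ψ q}.Infinite) :
    volume (W ψ β γ γ') = 1 := by
  refine le_antisymm ?_ ?_
  · calc volume (W ψ β γ γ') ≤ volume (Set.Icc (0 : ℝ) 1) := measure_mono fun x hx => hx.1
      _ = 1 := by simp
  · have h1 := (UnitAddCircle.measurePreserving_mk 0).quasiMeasurePreserving.ae hP
    rw [ae_restrict_iff' measurableSet_Ioc, zero_add] at h1
    calc 1 = volume (Set.Ioc (0 : ℝ) 1) := by simp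
      _ ≤ volume (W ψ β γ γ') := by
        refine measure_mono_ae ?_
        filter_upwards [h1] with x hx hx'
        exact ⟨Set.Ioc_subset_Icc_self hx', h x (hx hx')⟩

theorem norm_nsmul_sub_eq_distInt (q : ℕ) (x y : ℝ) :
    ‖q • (x : UnitAddCircle) - y‖ = distInt (q * x - y) := by
  rw [← norm_eq_distInt, AddCircle.coe_sub, coe_nat_mul]

theorem volume_W_eq_one_of_antitoneOn {ψ : ℕ → ℝ} (hψ0 : ∀ q : ℕ, 1 ≤ q → 0 ≤ ψ q)
    (hψ : AntitoneOn ψ (Set.Ici 1))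
    (hdiv : Filter.Tendsto (fun Q : ℕ => ∑ q ∈ Finset.Icc 3 Q, ψ q * logWeight q)
      Filter.atTop Filter.atTop) {γ β : ℝ} (γ' : ℝ) {A k₀ : ℕ}
    (hk₀ : 2 ≤ k₀)
    (hsc : ∀ k ≥ k₀, ScaleConditions (divisorScale A) (shellScale A) (diophScale A) k)
    (hw : ∀ k ≥ k₀, 2 ≤ diophScale A k)
    (hγ : ∀ k ≥ k₀, FarMultiples (γ : UnitAddCircle) (diophScale A k) k)
    (hβ : ∀ k ≥ k₀, FarMultiples (β : UnitAddCircle) (diophScale A k) k) :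
    volume (W ψ β γ γ') = 1 := by
  classical
  -- Truncation at `1/q` ensures `r q ≤ 2^(2h)/q`, needed for the case of large gcd and for `r q ≤
  -- 1/2`.
  set φ : ℕ → ℝ := fun q => min (ψ q) (1 / (q : ℝ)) with hφ
  have hφ0 : ∀ q, 1 ≤ q → 0 ≤ φ q := fun q hq => le_min (hψ0 q hq) (by positivity)
  have hφanti : AntitoneOn φ (Set.Ici 1) := by
    intro a ha b hb hab
    have ha' : (0 : ℝ) < a := by exact_mod_cast (Set.mem_Ici.1 ha)
    refine min_le_min (hψ ha hb hab) ?_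
    gcongr
  let good : ℕ → Prop :=
    GoodIndex (β : UnitAddCircle) (γ' : UnitAddCircle) (divisorScale A) (shellScale A) k₀
  set r : ℕ → ℝ := fun q =>
    if good q then φ q / ‖q • (β : UnitAddCircle) - (γ' : UnitAddCircle)‖ else 0 with hr
  have hrgood : ∀ q, good q → r q = φ q / ‖q • (β : UnitAddCircle) - (γ' : UnitAddCircle)‖ :=
    fun q hq => if_pos hq
  have hr0 : ∀ q, 0 ≤ r q := by
    intro q
    by_cases hq : good q
    · rw [hrgood q hq]
      exact div_nonneg (hφ0 q hq.pos) (norm_nonneg _)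
    · exact (if_neg hq).ge
  have hgood : ∀ q, 0 < r q → good q := by
    intro q hq
    by_contra hc
    exact hq.ne' (if_neg hc)
  have hrle : ∀ q, good q → r q ≤ 2 ^ (2 * shellScale A (Nat.log 2 q)) / q := by
    intro q hq
    have hq0 : (0 : ℝ) < q := by exact_mod_cast hq.pos
    have hn : 0 < ‖q • (β : UnitAddCircle) - (γ' : UnitAddCircle)‖ :=
      lt_of_lt_of_le (by positivity) hq.le_norm
    rw [hrgood q hq, div_le_div_iff₀ hn hq0]
    calc φ q * q ≤ 1 / q * q := by gcongr; exact min_le_right _ _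
      _ = 1 := by field_simp
      _ = 2 ^ (2 * shellScale A (Nat.log 2 q)) * (1 / 2) ^ (2 * shellScale A (Nat.log 2 q)) := by
        rw [← mul_pow]; norm_num
      _ ≤ _ := by gcongr; exact hq.le_norm
  have hrhalf : ∀ q, r q ≤ 1 / 2 := by
    intro q
    by_cases hq : good q
    · refine (hrle q hq).trans ?_
      have hq0 : (0 : ℝ) < q := by exact_mod_cast hq.pos
      have h1 : 2 ^ Nat.log 2 q ≤ q := Nat.pow_log_le_self 2 (by have := hq.pos; omega)
      have h2 := (hsc _ hq.le_log).small
      have h3 : 2 ^ (2 * shellScale A (Nat.log 2 q) + 1) ≤ q :=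
        (Nat.pow_le_pow_right (by norm_num) (by omega)).trans h1
      have h4 : (2 : ℝ) ^ (2 * shellScale A (Nat.log 2 q)) * 2 ≤ q := by
        rw [← pow_succ]; exact_mod_cast h3
      rw [div_le_div_iff₀ hq0 (by norm_num)]
      linarith
    · exact (if_neg hq).le.trans (by norm_num)
  have hnsr : ¬ Summable r := by
    intro hs
    refine not_summable_condensed_min (ψ := ψ) (A := A) (k₀ := k₀)
      (fun k hk => (hw k hk).trans (hsc k hk).le_shell)
      (not_summable_condensed hψ0 hψ hdiv hk₀ fun k hk => (hsc k hk).size) ?_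
    set g : ℕ → ℝ := fun k => shellScale A k * 2 ^ k * φ (2 ^ (k + 1)) with hg
    change Summable g
    have hg0 : ∀ k, 0 ≤ g k := fun k => by
      have := hφ0 (2 ^ (k + 1)) Nat.one_le_two_pow
      positivity
    have hblock : ∀ k ≥ k₀, g k / 32 ≤ ∑ q ∈ Finset.Ico (2 ^ k) (2 ^ (k + 1)), r q :=
      fun k hk => le_sum_block_of_goodIndex hk (hsc k hk) (hβ k hk) hφ0 hφanti hr0 hrgood
    have h1 : Summable fun i => g (i + k₀) / 32 := by
      refine summable_of_sum_range_le (c := ∑' q, r q) (fun i => by have := hg0 (i + k₀); positivity)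
        fun n => ?_
      have h2 := le_sum_Ico_two_pow (f := fun k => g k / 32) hblock n
      simp only [add_comm k₀] at h2
      exact h2.trans (hs.sum_le_tsum _ fun q _ => hr0 q)
    have h2 : Summable fun i => g (i + k₀) := by
      have := h1.mul_right 32
      simpa using this
    exact (summable_nat_add_iff k₀).1 h2
  have hrdiv : Filter.Tendsto (fun N : ℕ => ∑ q ∈ Finset.Icc 1 N, r q)
      Filter.atTop Filter.atTop := by
    have h1 := (not_summable_iff_tendsto_nat_atTop_of_nonneg hr0).1 hnsr
    refine (h1.comp (Filter.tendsto_add_atTop_nat 1)).congr fun N => ?_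
    change ∑ q ∈ Finset.range (N + 1), r q = _
    refine (Finset.sum_subset ?_ ?_).symm
    · intro q hq
      rw [Finset.mem_Icc] at hq
      exact Finset.mem_range.2 (by omega)
    · intro q hq hq'
      rw [Finset.mem_range] at hq
      rw [Finset.mem_Icc] at hq'
      have hq0 : q = 0 := by omega
      exact if_neg fun hc => by have := hc.pos; omega
  have hae := ae_infinite_mem_nearSet (γ : UnitAddCircle) r hr0 hrhalf 12
    (fun q' _ hq' s hs hne => sum_gcd_div_le_of_goodIndex hsc hγ hβ
      (fun q hq => ⟨hgood q hq, hrle q (hgood q hq)⟩) hq' hs hne) hrdiv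
  refine volume_W_eq_one_of_ae hae fun x hx => hx.mono ?_
  rintro q ⟨hq1, hq⟩
  refine ⟨hq1, ?_⟩
  have hq' : ‖q • (x : UnitAddCircle) - (γ : UnitAddCircle)‖ < r q := hq
  have hgq := hgood q ((norm_nonneg _).trans_lt hq')
  have hn : 0 < ‖q • (β : UnitAddCircle) - (γ' : UnitAddCircle)‖ :=
    lt_of_lt_of_le (by positivity) hgq.le_norm
  rw [hrgood q hgq, lt_div_iff₀ hn, norm_nsmul_sub_eq_distInt, norm_nsmul_sub_eq_distInt] at hq'
  exact hq'.trans_le (min_le_left _ _)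

theorem distInt_le_half (x : ℝ) : distInt x ≤ 1 / 2 := abs_sub_round x

/-- Here every `x` works: `‖qβ - γ'‖ < ψ(q₀) ≤ ψ(q)` already suffices, since the other factor is at
most `1/2`. -/
theorem volume_W_eq_one_of_monotoneOn {ψ : ℕ → ℝ} (hψ : MonotoneOn ψ (Set.Ici 1)) {q₀ : ℕ}
    (hq₀ : 1 ≤ q₀) (hpos : 0 < ψ q₀) {β : ℝ} (γ γ' : ℝ)
    (hβ : ∀ ε > 0, ∀ n : ℕ, ∃ q ≥ n, distInt (q * β - γ') < ε) :
    volume (W ψ β γ γ') = 1 := by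
  refine volume_W_eq_one_of_ae (P := fun _ => True) (Filter.Eventually.of_forall fun _ => trivial)
    fun x _ => ?_
  rw [← Nat.frequently_atTop_iff_infinite, Filter.frequently_atTop]
  intro n
  obtain ⟨q, hq, hqβ⟩ := hβ (ψ q₀) hpos (max n q₀)
  have hqq : q₀ ≤ q := (le_max_right _ _).trans hq
  refine ⟨q, (le_max_left _ _).trans hq, hq₀.trans hqq, ?_⟩
  have h0 : 0 ≤ distInt (q * β - γ') := abs_nonneg _
  calc distInt (q * x - γ) * distInt (q * β - γ') ≤ 1 * distInt (q * β - γ') := by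
        gcongr; linarith [distInt_le_half (q * x - γ)]
    _ < ψ q₀ := by rwa [one_mul]
    _ ≤ ψ q := hψ (Set.mem_Ici.2 hq₀) (Set.mem_Ici.2 (hq₀.trans hqq)) hqq

/-- The shell of exponent `h k` in block `k` is nonempty, and `h k` is unbounded. -/
theorem exists_distInt_lt_of_scaleConditions {β : ℝ} (γ' : ℝ) {A k₀ : ℕ} (hA : 1 ≤ A)
    (hsc : ∀ k ≥ k₀, ScaleConditions (divisorScale A) (shellScale A) (diophScale A) k)
    (hβ : ∀ k ≥ k₀, FarMultiples (β : UnitAddCircle) (diophScale A k) k) (ε : ℝ) (hε : 0 < ε)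
    (n : ℕ) : ∃ q ≥ n, distInt (q * β - γ') < ε := by
  obtain ⟨j, hj⟩ := exists_pow_lt_of_lt_one hε (by norm_num : (1 / 2 : ℝ) < 1)
  obtain ⟨k₁, hk₁⟩ := exists_forall_le_sqrt_log (j + 1)
  set k := max (max k₀ k₁) n
  have hk0 : k₀ ≤ k := (le_max_left _ _).trans (le_max_left _ _)
  have hkn : n ≤ k := le_max_right _ _
  have hS := hsc k hk0
  have hw : j + 1 ≤ diophScale A k :=
    (hk₁ k ((le_max_right _ _).trans (le_max_left _ _))).trans (Nat.le_mul_of_pos_left _ hA)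
  have hh : j + 1 ≤ shellScale A k := hw.trans hS.le_shell
  have h1 := (hβ k hk0).le_card_shell (γ' : UnitAddCircle) (j := shellScale A k) (by omega)
    (by have := hS.small; nlinarith)
  have h2 := Nat.cast_pos.1 (lt_of_lt_of_le (by positivity) h1)
  obtain ⟨q, hq⟩ := Finset.card_pos.1 h2
  obtain ⟨hqI, -, hq2⟩ := Finset.mem_filter.1 hq
  refine ⟨q, ?_, ?_⟩
  · have : k < 2 ^ k := Nat.lt_two_pow_self
    have := (Finset.mem_Ico.1 hqI).1
    omega
  · rw [← norm_nsmul_sub_eq_distInt]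
    exact (hq2.trans (pow_le_pow_of_le_one (by norm_num) (by norm_num) (by omega))).trans_lt hj

theorem theorem1p4
    (ψ : ℕ → ℝ)
    (hψ_nonneg : ∀ q : ℕ, 1 ≤ q → 0 ≤ ψ q)
    (hψ_mono : AntitoneOn ψ (Set.Ici 1) ∨ MonotoneOn ψ (Set.Ici 1))
    (hψ_div : Filter.Tendsto
      (fun Q : ℕ => ∑ q ∈ Finset.Icc 3 Q,
        ψ q * (Real.logb 2 q / Real.sqrt (Real.logb 2 (Real.logb 2 q))))
      Filter.atTop Filter.atTop)
    (γ β : ℝ) (hγ : Irrational γ) (hβ : Irrational β)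
    (hσ : ∃ C : ℝ, ∀ q : ℕ, 3 ≤ q →
      sigmaPair γ β q ≤ ENNReal.ofReal (C * Real.sqrt (Real.logb 2 (Real.logb 2 q))))
    (γ' : ℝ) :
    MeasureTheory.volume (W ψ β γ γ') = 1 := by
  obtain ⟨A, hA, hfar⟩ := exists_farMultiples hσ
  obtain ⟨k₁, hk₁⟩ := exists_forall_le_sqrt_log (9 * A + 12)
  set k₀ := max k₁ 2
  have hk₀ : 2 ≤ k₀ := le_max_right _ _
  have hm : ∀ k ≥ k₀, 9 * A + 12 ≤ Nat.sqrt (Nat.log 2 k) := fun k hk =>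
    hk₁ k ((le_max_left _ _).trans hk)
  have hsc : ∀ k ≥ k₀, ScaleConditions (divisorScale A) (shellScale A) (diophScale A) k :=
    fun k hk => scaleConditions_of_le hA (hm k hk) (by omega)
  rcases hψ_mono with hψ | hψ
  · refine volume_W_eq_one_of_antitoneOn hψ_nonneg hψ hψ_div γ' hk₀ hsc (fun k hk => ?_)
      (fun k hk => (hfar k (hk₀.trans hk)).1) (fun k hk => (hfar k (hk₀.trans hk)).2)
    exact (by have := hm k hk; omega : 2 ≤ Nat.sqrt (Nat.log 2 k)).trans
      (Nat.le_mul_of_pos_left _ hA)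
  · obtain ⟨q₀, hq₀, hpos⟩ : ∃ q₀, 1 ≤ q₀ ∧ 0 < ψ q₀ := by
      by_contra! hc
      obtain ⟨Q, hQ⟩ := (hψ_div.eventually_gt_atTop 0).exists
      refine absurd hQ (not_lt.2 (Finset.sum_nonpos fun q hq => ?_))
      have hq1 : 1 ≤ q := by have := (Finset.mem_Icc.1 hq).1; omega
      exact mul_nonpos_of_nonpos_of_nonneg (hc q hq1) (logWeight_nonneg hq1)
    exact volume_W_eq_one_of_monotoneOn hψ hq₀ hpos γ γ'
      (exists_distInt_lt_of_scaleConditions γ' hA hsc fun k hk => (hfar k (hk₀.trans hk)).2)
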